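/- Let $G$ be a second countable locally compact Hausdorff groupoid with unit space $G^0$, range and source maps $r,s$, fibres $G^u=r^{-1}(u)$, and a left Haar system $\{\lambda^u\}_{u\in G^0}$. All Hilbert spaces are separable, with inner products conjugate linear in the first variable. A function $\phi:G\to\mathbb C$ is in $P(G)$ (is positive definite) if it is bounded and continuous and, for all $u\in G^0$ and $f\in C_c(G)$, $$\iint \phi(y^{-1}x)\,f(y)\,\overline{f(x)}\,d\lambda^u(x)\,d\lambda^u(y)\ \ge 0 .$$ A $G$-Hilbert bundle is a continuous field $\{\mathfrak H^u\}_{u\in G^0}$ of Hilbert spaces (in the sense of Dixmier) together with surjective linear isometries $L_x:\mathfrak H^{s(x)}\to\mathfrak H^{r(x)}$ ($x\in G$) such that $x\mapsto L_x$ is a groupoid homomorphism and, for all bounded continuous sections $\xi,\eta$, the function $(\xi,\eta):x\mapsto (L_x\xi(s(x)),\eta(r(x)))$ is continuous on $G$. The Fourier-Stieltjes algebra $B(G)$ is the set of all functions $(\xi,\eta)$, for bounded continuous sections $\xi,\eta$ of some $G$-Hilbert bundle. For $\phi:G\to\mathbb C$ put $\phi^*(x)=\overline{\phi(x^{-1})}$.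 Let $I_2=\{1,2\}\times\{1,2\}$ be the trivial groupoid on two points. The product groupoid $G\times I_2$ consists of the triples $(x,i,j)$ with $x\in G$, $i,j\in\{1,2\}$, where $(x,i,j)$ has range $(r(x),i)$ and source $(s(x),j)$; it carries the product topology and the Haar system whose measure at $(u,i)$ is $\lambda^u$ times counting measure on $\{(i,1),(i,2)\}$. Then a function $\phi:G\to\mathbb C$ lies in $B(G)$ if and only if there exist $F\in P(G\times I_2)$ and $\rho,\tau\in P(G)$ such that for all $x\in G$ $$\begin{bmatrix} F(x,1,1) & F(x,1,2)\\ F(x,2,1) & F(x,2,2)\end{bmatrix}=\begin{bmatrix}\rho(x)&\phi(x)\\ \phi^*(x)&\tau(x)\end{bmatrix}.$$ -/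

import Mathlib

open CategoryTheory MeasureTheory Topology
open scoped ComplexOrder

universe w v u

noncomputable section

namespace LCGroupoid

/-! ### Topological groupoids

A groupoid `G` is a Mathlib `Groupoid X`: the objects `X` are the unit space `G⁰`, and a morphism
`x : s ⟶ r` is an element of `G` with source `s` and range `r`.  The product of groupoid elements
`xy`, defined when `s(x) = r(y)`, is therefore the composition `y ≫ x`. -/

/-- The set `G` of all elements (arrows) of the groupoid. -/
abbrev Arr (X : Type u) [Groupoid.{v} X] : Type (max u v) := Quiver.Total X

/-- A single morphism as an element of `G`. -/
abbrev Arr.of {X : Type u} [Groupoid.{v} X] {a b : X} (x : a ⟶ b) : Arr X := ⟨a, b, x⟩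

/-- The source map `s : G → G⁰`. -/
abbrev Arr.s {X : Type u} [Groupoid.{v} X] (x : Arr X) : X := x.left

/-- The range map `r : G → G⁰`. -/
abbrev Arr.r {X : Type u} [Groupoid.{v} X] (x : Arr X) : X := x.right

/-- The inverse `x⁻¹`. -/
def Arr.inv {X : Type u} [Groupoid.{v} X] (x : Arr X) : Arr X := Arr.of (Groupoid.inv x.hom)

/-- The set `G²` of pairs `(x, y)` of elements of `G` with `s(x) = r(y)`. -/
structure Composable (X : Type u) [Groupoid.{v} X] where
  /-- the source of `y` -/
  a : X
  /-- the range of `y` and source of `x` -/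
  b : X
  /-- the range of `x` -/
  c : X
  /-- the second element of the pair -/
  y : a ⟶ b
  /-- the first element of the pair -/
  x : b ⟶ c

/-- The inclusion of `G²` into `G × G`. -/
def Composable.toPair {X : Type u} [Groupoid.{v} X] (p : Composable X) : Arr X × Arr X :=
  (Arr.of p.x, Arr.of p.y)

/-- The product `xy` of `(x, y) ∈ G²`. -/
def Composable.mul {X : Type u} [Groupoid.{v} X] (p : Composable X) : Arr X :=
  Arr.of (p.y ≫ p.x)

/-- `G²` has the relative topology of `G × G`. -/
instance (X : Type u) [Groupoid.{v} X] [TopologicalSpace (Arr X)] :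
    TopologicalSpace (Composable X) :=
  TopologicalSpace.induced Composable.toPair inferInstance

/-- `φ*(x) = conj (φ (x⁻¹))`. -/
def adj {X : Type u} [Groupoid.{v} X] (φ : Arr X → ℂ) : Arr X → ℂ :=
  fun x => starRingEnd ℂ (φ x.inv)

/-- A topological groupoid: `G⁰` and `G` are topological spaces and all structure maps are
continuous.  (Then `u ↦ 𝟙 u` is an embedding of `G⁰` into `G`.) -/
class TopGroupoid (X : Type u) [Groupoid.{v} X] [TopologicalSpace X]
    [TopologicalSpace (Arr X)] : Prop where
  continuous_s : Continuous (Arr.s : Arr X → X)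
  continuous_r : Continuous (Arr.r : Arr X → X)
  continuous_unit : Continuous (fun a : X => (Arr.of (𝟙 a) : Arr X))
  continuous_inv : Continuous (Arr.inv : Arr X → Arr X)
  continuous_mul : Continuous (Composable.mul : Composable X → Arr X)

/-! ### Haar systems -/

/-- The fibre `Gᵘ = r⁻¹(u)`. -/
structure RFiber (X : Type u) [Groupoid.{v} X] (a : X) where
  /-- the source of the element -/
  src : X
  /-- the element itself -/
  hom : src ⟶ a

/-- An element of `Gᵘ` as an element of `G`. -/
def RFiber.toArr {X : Type u} [Groupoid.{v} X] {a : X} (x : RFiber X a) : Arr X := Arr.of x.hom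

/-- Left translation `z ↦ xz` from `G^{s(x)}` to `G^{r(x)}`. -/
def RFiber.translate {X : Type u} [Groupoid.{v} X] {a b : X} (x : a ⟶ b) (z : RFiber X a) :
    RFiber X b := ⟨z.src, z.hom ≫ x⟩

/-- The element `y⁻¹x` of `G`, for `x, y ∈ Gᵘ`. -/
def RFiber.invMul {X : Type u} [Groupoid.{v} X] {a : X} (y x : RFiber X a) : Arr X :=
  Arr.of (x.hom ≫ Groupoid.inv y.hom)

/-- `Gᵘ` has the relative topology of `G`. -/
instance (X : Type u) [Groupoid.{v} X] [TopologicalSpace (Arr X)] (a : X) :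
    TopologicalSpace (RFiber X a) :=
  TopologicalSpace.induced RFiber.toArr inferInstance

instance (X : Type u) [Groupoid.{v} X] [TopologicalSpace (Arr X)] (a : X) :
    MeasurableSpace (RFiber X a) := borel _

instance (X : Type u) [Groupoid.{v} X] [TopologicalSpace (Arr X)] (a : X) :
    BorelSpace (RFiber X a) := ⟨rfl⟩

/-- A left Haar system: Borel measures `λᵘ` on the fibres `Gᵘ`, finite on compact sets (on the
second countable locally compact Hausdorff spaces `Gᵘ` this is the same as Radon) and with support
all of `Gᵘ`, such that `u ↦ ∫ f dλᵘ` is continuous for `f ∈ C_c(G)`, and such that `z ↦ xz`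
carries `λ^{s(x)}` to `λ^{r(x)}`. -/
structure IsHaarSystem {X : Type u} [Groupoid.{v} X] [TopologicalSpace X]
    [TopologicalSpace (Arr X)] (lam : ∀ a : X, Measure (RFiber X a)) : Prop where
  finite_on_compacts : ∀ a, IsFiniteMeasureOnCompacts (lam a)
  full_support : ∀ a, (lam a).IsOpenPosMeasure
  continuous_integral : ∀ f : Arr X → ℂ, Continuous f → HasCompactSupport f →
    Continuous (fun a : X => ∫ x, f x.toArr ∂(lam a))
  left_invariant : ∀ {a b : X} (x : a ⟶ b), (lam a).map (RFiber.translate x) = lam b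

/-! ### Continuous positive definite functions -/

/-- `P(G)`: the bounded continuous `φ : G → ℂ` with
`∬ φ(y⁻¹x) f(y) conj(f(x)) dλᵘ(x) dλᵘ(y) ≥ 0` for all `u ∈ G⁰`, `f ∈ C_c(G)`
(`0 ≤ z` for complex `z` means that `z` is real and nonnegative). -/
def PosDef {X : Type u} [Groupoid.{v} X] [TopologicalSpace (Arr X)]
    (lam : ∀ a : X, Measure (RFiber X a)) : Set (Arr X → ℂ) :=
  {φ | Continuous φ ∧ (∃ C : ℝ, ∀ x, ‖φ x‖ ≤ C) ∧
    ∀ (a : X) (f : Arr X → ℂ), Continuous f → HasCompactSupport f →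
      0 ≤ ∫ y, ∫ x, φ (y.invMul x) * f y.toArr * starRingEnd ℂ (f x.toArr) ∂(lam a) ∂(lam a)}

/-! ### Hilbert bundles and the Fourier-Stieltjes algebra -/

/-- A continuous field of separable Hilbert spaces over `X`, in the sense of Dixmier: fibres `H a`
and a linear space `Γ` of (continuous) sections that is pointwise dense, has continuous norm
functions, and is closed under local uniform approximation. -/
structure HilbertBundle (X : Type u) [TopologicalSpace X] where
  /-- the fibres -/
  H : X → Type w
  [normed : ∀ a, NormedAddCommGroup (H a)]
  [inner : ∀ a, InnerProductSpace ℂ (H a)]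
  [complete : ∀ a, CompleteSpace (H a)]
  [separable : ∀ a, TopologicalSpace.SeparableSpace (H a)]
  /-- the continuous sections -/
  Γ : Submodule ℂ (∀ a, H a)
  dense : ∀ a, Dense {h : H a | ∃ ξ ∈ Γ, ξ a = h}
  continuous_norm : ∀ ξ ∈ Γ, Continuous (fun a => ‖ξ a‖)
  locally_closed : ∀ ξ : ∀ a, H a,
    (∀ a, ∀ ε > (0 : ℝ), ∃ ξ' ∈ Γ, ∀ᶠ b in 𝓝 a, ‖ξ b - ξ' b‖ ≤ ε) → ξ ∈ Γ

attribute [instance] HilbertBundle.normed HilbertBundle.inner HilbertBundle.complete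
  HilbertBundle.separable

/-- `Δ_b`: the bounded continuous sections. -/
def HilbertBundle.boundedSections {X : Type u} [TopologicalSpace X]
    (E : HilbertBundle.{w} X) : Set (∀ a, E.H a) :=
  {ξ | ξ ∈ E.Γ ∧ ∃ C : ℝ, ∀ a, ‖ξ a‖ ≤ C}

/-- The function `x ↦ (L_x ξ(s(x)), η(r(x)))` on `G`; Mathlib's inner product is conjugate linear
in the first variable. -/
def coeffFun {X : Type u} [Groupoid.{v} X] [TopologicalSpace X] (E : HilbertBundle.{w} X)
    (L : ∀ {a b : X}, (a ⟶ b) → (E.H a ≃ₗᵢ[ℂ] E.H b)) (ξ η : ∀ a, E.H a) : Arr X → ℂ :=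
  fun x => inner ℂ (L x.hom (ξ x.left)) (η x.right)

/-- A `G`-Hilbert bundle: a Hilbert bundle over `G⁰` with surjective linear isometries
`L_x : H_{s(x)} → H_{r(x)}`, multiplicative in `x`, such that all
`x ↦ (L_x ξ(s(x)), η(r(x)))` with `ξ, η ∈ Δ_b` are continuous. -/
structure GHilbertBundle (X : Type u) [Groupoid.{v} X] [TopologicalSpace X]
    [TopologicalSpace (Arr X)] extends HilbertBundle.{w} X where
  /-- the action -/
  L : ∀ {a b : X}, (a ⟶ b) → (H a ≃ₗᵢ[ℂ] H b)
  L_id : ∀ (a : X) (h : H a), L (𝟙 a) h = h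
  L_comp : ∀ {a b c : X} (y : a ⟶ b) (x : b ⟶ c) (h : H a), L (y ≫ x) h = L x (L y h)
  continuous_coeff : ∀ ξ ∈ toHilbertBundle.boundedSections,
    ∀ η ∈ toHilbertBundle.boundedSections, Continuous (coeffFun toHilbertBundle L ξ η)

/-- The Fourier-Stieltjes algebra `B(G)`: all coefficients `(ξ, η)` of `G`-Hilbert bundles with
`ξ, η ∈ Δ_b`.  (Fibres are taken in the universe of `G`.  This is no restriction, since every
universe has an isometric copy of each separable Hilbert space.) -/
def FourierStieltjes (X : Type u) [Groupoid.{v} X] [TopologicalSpace X]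
    [TopologicalSpace (Arr X)] : Set (Arr X → ℂ) :=
  {φ | ∃ E : GHilbertBundle.{max u v} X,
    ∃ ξ ∈ E.boundedSections, ∃ η ∈ E.boundedSections, φ = coeffFun E.toHilbertBundle E.L ξ η}

/-! ### The groupoid `G × I₂` -/

/-- The trivial groupoid `I₂ = {1, 2} × {1, 2}`: two objects, and exactly one arrow `(i, j)` with
range `i` and source `j` for all `i, j`. -/
abbrev I₂ : Type := Codiscrete (Fin 2)

instance : Groupoid.{0} I₂ where
  inv _ := ()

instance : TopologicalSpace I₂ := ⊥

instance : DiscreteTopology I₂ := ⟨rfl⟩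

/-- The element `(x, i, j)` of `G × I₂`, with range `(r(x), i)` and source `(s(x), j)`. -/
def Arr.entry {X : Type u} [Groupoid.{v} X] (x : Arr X) (i j : Fin 2) : Arr (X × I₂) :=
  ⟨(x.left, ⟨j⟩), (x.right, ⟨i⟩), (x.hom, ())⟩

/-- The bijection `(x, i, j) ↦ (x, (i, j))` of the product groupoid onto the product set. -/
def Arr.split {X : Type u} [Groupoid.{v} X] (z : Arr (X × I₂)) : Arr X × I₂ × I₂ :=
  (⟨z.left.1, z.right.1, z.hom.1⟩, z.right.2, z.left.2)

/-- `G × I₂` has the product topology, `I₂` being discrete. -/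
instance (X : Type u) [Groupoid.{v} X] [TopologicalSpace (Arr X)] :
    TopologicalSpace (Arr (X × I₂)) :=
  TopologicalSpace.induced Arr.split inferInstance

/-- For `x ∈ Gᵘ`, the element `(x, i, j)` of the fibre of `G × I₂` over `(u, i)`. -/
def RFiber.entry {X : Type u} [Groupoid.{v} X] {a : X} (i j : Fin 2) (x : RFiber X a) :
    RFiber (X × I₂) (a, ⟨i⟩) := ⟨(x.src, ⟨j⟩), (x.hom, ())⟩

/-- The Haar system of `G × I₂`: `λᵘ` times counting measure on `{(i, 1), (i, 2)}`. -/
def prodHaar {X : Type u} [Groupoid.{v} X] [TopologicalSpace (Arr X)]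
    (lam : ∀ a : X, Measure (RFiber X a)) (p : X × I₂) : Measure (RFiber (X × I₂) p) :=
  ∑ j : Fin 2, (lam p.1).map (RFiber.entry p.2.as j)

/-- A function `F` on `G × I₂` as a `2 × 2` matrix valued function on `G`. -/
def toMatrix {X : Type u} [Groupoid.{v} X] (F : Arr (X × I₂) → ℂ) (x : Arr X) :
    Matrix (Fin 2) (Fin 2) ℂ :=
  Matrix.of fun i j => F (x.entry i j)

end LCGroupoid

end

/-! A coefficient matrix is a Gram matrix, and every continuous Gram matrix on the fibres comes from
a bundle. If `φ = (ξ, η)`, the 2 × 2 matrix of coefficients of `η, ξ` is a function `F` on `G × I₂`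
whose kernel `F(y⁻¹x)` on each fibre is the Gram kernel of the vectors `L_x ξ_j(s(x))`. Its double
integral against `f` is therefore the squared norm of a vector-valued integral
(`integral_integral_inner_nonneg`).

For the converse, bump functions turn the integrated positivity of `F` into positivity of all finite
quadratic forms on a fibre (`isPosDefKernel_of_integral_nonneg`). The fibre of `G × I₂` over `(u,
1)` is two copies of `Gᵘ`, so the GNS construction gives a Hilbert space `H_u` spanned by vectors
`e(x, j)`, `x ∈ Gᵘ`, with `(e(x, j), e(y, i)) = F(y⁻¹x, i, j)`. Left translation preserves these
inner products, which defines the action `L_z e(x, j) = e(zx, j)`. The sections `ξ_j(u) = e(u, j)`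
then have coefficients `(L_x ξ_j, ξ_i) = F(x, i, j)`, and `φ` is the entry `(1, 2)`.

The remaining work is the continuous field structure. Integrating the `e(x, j)` against `C_c(G)`
with the Haar system gives sections that are pointwise dense (`IsGNSFamily.dense_sections`) and have
continuous coefficients (`IsGNSFamily.continuous_coeff`). Their local uniform closure is the field,
and it contains the `ξ_j` because these have continuous norms and continuous inner products with the
integrated sections. -/

noncomputable section

namespace LCGroupoid

/-! ### Hilbert spaces of positive definite kernels -/

section Kernel

variable {Z : Type u}

/-- A complex kernel is positive definite if all its finite quadratic forms are nonnegative. -/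
def IsPosDefKernel (k : Z → Z → ℂ) : Prop :=
  ∀ (s : Finset Z) (c : Z → ℂ), 0 ≤ ∑ x ∈ s, ∑ y ∈ s, starRingEnd ℂ (c x) * c y * k x y

/-- Nonnegative forms are real. One-point forms make the diagonal real; the weights `(1, 1)` and
`(1, i)` on two points then compare imaginary and real parts. -/
theorem IsPosDefKernel.conj_symm {k : Z → Z → ℂ} (hk : IsPosDefKernel k) (x y : Z) :
    starRingEnd ℂ (k x y) = k y x := by
  classical
  have diag : ∀ x, (k x x).im = 0 := fun x => by
    have := (Complex.le_def.1 (hk {x} 1)).2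
    simpa using this.symm
  by_cases hxy : x = y
  · subst hxy
    exact Complex.conj_eq_iff_im.2 (diag x)
  have h1 := (Complex.le_def.1 (hk {x, y} 1)).2
  have h2 := (Complex.le_def.1 (hk {x, y} (fun z => if z = x then 1 else Complex.I))).2
  have dx := diag x
  have dy := diag y
  simp [Finset.sum_pair hxy, Ne.symm hxy, dx, dy] at h1 h2
  apply Complex.ext <;> simp <;> linarith

/-- Moore–Aronszajn: the space is the reproducing kernel Hilbert space of `k`, read as a kernel of
operators on `ℂ`, and `e x` is the kernel function at `x`. -/
theorem IsPosDefKernel.exists_hilbertSpace {k : Z → Z → ℂ} (hk : IsPosDefKernel k) :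
    ∃ (H : Type u) (_ : NormedAddCommGroup H) (_ : InnerProductSpace ℂ H) (_ : CompleteSpace H)
      (e : Z → H), (∀ x y, inner ℂ (e x) (e y) = k x y) ∧
        (Submodule.span ℂ (Set.range e)).topologicalClosure = ⊤ := by
  classical
  let K : Matrix Z Z (ℂ →L[ℂ] ℂ) := Matrix.of fun y x => k y x • ContinuousLinearMap.id ℂ ℂ
  have hherm : K.IsHermitian := by
    ext1 x y
    rw [Matrix.conjTranspose_apply]
    simp only [K, Matrix.of_apply, star_smul]
    rw [← hk.conj_symm y x]
    congr 1
    exact star_one (ℂ →L[ℂ] ℂ)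
  have hK : K.PosSemidef := by
    have tfae := (RKHS.posSemidef_tfae (K := K)).out 0 2
    refine tfae.2 ⟨hherm, fun f => ?_⟩
    have := (Complex.le_def.1 (hk f.support f)).1
    refine this.trans_eq ?_
    rw [Finset.sum_comm] at *
    simp only [Finsupp.sum, K, Matrix.of_apply, RCLike.re_eq_complex_re]
    congr 1
    rw [Finset.sum_comm]
    refine Finset.sum_congr rfl fun x _ => Finset.sum_congr rfl fun y _ => ?_
    rw [RCLike.inner_apply]
    simp [hk.conj_symm]
    ring
  have : Fact K.PosSemidef := ⟨hK⟩
  refine ⟨RKHS.OfKernel K, inferInstance, inferInstance, inferInstance,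
    fun x => RKHS.kerFun (RKHS.OfKernel K) x 1, fun x y => ?_, ?_⟩
  · rw [← RKHS.kernel_inner, RKHS.OfKernel.kernel_ofKernel]
    simp [K, hk.conj_symm]
  · rw [eq_top_iff, ← RKHS.kerFun_dense (RKHS.OfKernel K)]
    refine Submodule.topologicalClosure_mono (Submodule.span_le.2 ?_)
    rintro _ ⟨x, c, rfl⟩
    have : RKHS.kerFun (RKHS.OfKernel K) x c = c • RKHS.kerFun (RKHS.OfKernel K) x 1 := by
      rw [← map_smul]; simp
    rw [this]
    exact Submodule.smul_mem _ _ (Submodule.subset_span ⟨x, rfl⟩)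

variable {H H' : Type*} [NormedAddCommGroup H] [InnerProductSpace ℂ H]
  [NormedAddCommGroup H'] [InnerProductSpace ℂ H']

theorem denseRange_linearCombination {e : Z → H}
    (he : (Submodule.span ℂ (Set.range e)).topologicalClosure = ⊤) :
    DenseRange (Finsupp.linearCombination ℂ e) := by
  rw [← Finsupp.range_linearCombination, ← Submodule.dense_iff_topologicalClosure_eq_top] at he
  exact he

/-- Equal Gram kernels give equal norms to corresponding linear combinations, so the identity on
coefficients extends to the completions. -/
theorem exists_linearIsometryEquiv [CompleteSpace H] [CompleteSpace H'] {e : Z → H} {e' : Z → H'}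
    (he : (Submodule.span ℂ (Set.range e)).topologicalClosure = ⊤)
    (he' : (Submodule.span ℂ (Set.range e')).topologicalClosure = ⊤)
    (h : ∀ x y, inner ℂ (e x) (e y) = inner ℂ (e' x) (e' y)) :
    ∃ L : H ≃ₗᵢ[ℂ] H', ∀ x, L (e x) = e' x := by
  have hn : ∀ c : Z →₀ ℂ, ‖Finsupp.linearCombination ℂ e' (LinearEquiv.refl ℂ _ c)‖ =
      ‖Finsupp.linearCombination ℂ e c‖ := fun c => by
    have : inner ℂ (Finsupp.linearCombination ℂ e' c) (Finsupp.linearCombination ℂ e' c) =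
        inner ℂ (Finsupp.linearCombination ℂ e c) (Finsupp.linearCombination ℂ e c) := by
      simp only [Finsupp.linearCombination_apply, Finsupp.sum, sum_inner, inner_sum,
        inner_smul_left, inner_smul_right, h]
    rw [@norm_eq_sqrt_re_inner ℂ, @norm_eq_sqrt_re_inner ℂ H, LinearEquiv.refl_apply, this]
  refine ⟨(LinearEquiv.refl ℂ (Z →₀ ℂ)).extendOfIsometry _ _ (denseRange_linearCombination he)
    (denseRange_linearCombination he') hn, fun x => ?_⟩
  have := (LinearEquiv.refl ℂ (Z →₀ ℂ)).extendOfIsometry_eq _ _ (denseRange_linearCombination he)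
    (denseRange_linearCombination he') hn (Finsupp.single x 1)
  simpa using this

theorem linearIsometryEquiv_ext_of_dense {e : Z → H}
    (he : (Submodule.span ℂ (Set.range e)).topologicalClosure = ⊤)
    {L L' : H ≃ₗᵢ[ℂ] H'} (h : ∀ x, L (e x) = L' (e x)) : L = L' := by
  ext z
  refine congrFun ((denseRange_linearCombination he).equalizer L.continuous L'.continuous ?_) z
  ext c
  simp [Finsupp.linearCombination_apply, Finsupp.sum, h]

theorem continuous_of_continuous_inner [TopologicalSpace Z] {e : Z → H}
    (h : Continuous fun p : Z × Z => inner ℂ (e p.1) (e p.2)) : Continuous e := by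
  rw [continuous_iff_continuousAt]
  intro x
  have key : ∀ y, ‖e y - e x‖ ^ 2 =
      (inner ℂ (e y) (e y) - inner ℂ (e y) (e x) - inner ℂ (e x) (e y) + inner ℂ (e x) (e x)).re :=
    fun y => by
      rw [← @inner_self_eq_norm_sq ℂ]
      simp only [inner_sub_left, inner_sub_right, RCLike.re_eq_complex_re]
      congr 1; ring
  have h1 : Continuous fun y => inner ℂ (e y) (e y) := h.comp (continuous_id.prodMk continuous_id)
  have h2 : Continuous fun y => inner ℂ (e y) (e x) := h.comp (continuous_id.prodMk continuous_const)
  have h3 : Continuous fun y => inner ℂ (e x) (e y) := h.comp (continuous_const.prodMk continuous_id)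
  have hc : Continuous fun y => ‖e y - e x‖ := by
    have : (fun y => ‖e y - e x‖) = fun y => Real.sqrt (‖e y - e x‖ ^ 2) := by
      ext y; rw [Real.sqrt_sq (norm_nonneg _)]
    rw [this]
    simp only [key]
    exact Real.continuous_sqrt.comp (Complex.continuous_re.comp
      (((h1.sub h2).sub h3).add continuous_const))
  rw [ContinuousAt, tendsto_iff_norm_sub_tendsto_zero]
  simpa using hc.tendsto x

end Kernel

/-! ### Integration against compactly supported functions -/

section Integral

variable {Z : Type*} [TopologicalSpace Z] [MeasurableSpace Z] [BorelSpace Z]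
  {A : Type*} [TopologicalSpace A] {ι : Z → A} {μ : Measure Z}
  {H : Type*} [NormedAddCommGroup H] [InnerProductSpace ℂ H]

theorem integrable_smul_of_hasCompactSupport [IsFiniteMeasureOnCompacts μ] {f : Z → ℂ} {e : Z → H}
    (hf : Continuous f) (hfc : HasCompactSupport f) (he : Continuous e) :
    Integrable (fun x => f x • e x) μ :=
  (hf.smul he).integrable_of_hasCompactSupport hfc.smul_right

variable [CompleteSpace H]

/-- The double integral is `‖∫ f e dμ‖²`. -/
theorem integral_integral_inner_nonneg [IsFiniteMeasureOnCompacts μ] {f : Z → ℂ} {e : Z → H}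
    (hf : Continuous f) (hfc : HasCompactSupport f) (he : Continuous e) :
    0 ≤ ∫ y, ∫ x, inner ℂ (e x) (e y) * f y * starRingEnd ℂ (f x) ∂μ ∂μ := by
  have hi := integrable_smul_of_hasCompactSupport (μ := μ) hf hfc he
  have h1 : ∀ y, ∫ x, inner ℂ (e x) (e y) * f y * starRingEnd ℂ (f x) ∂μ =
      inner ℂ (∫ x, f x • e x ∂μ) (f y • e y) := fun y => by
    rw [← inner_conj_symm, ← integral_inner hi, ← integral_conj]
    congr 1; ext x
    rw [inner_conj_symm, inner_smul_left, inner_smul_right]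
    ring
  simp only [h1]
  rw [integral_inner hi, inner_self_eq_norm_sq_to_K]
  simp

/-- Normalized bump functions on the ambient space of a closed subspace. -/
theorem exists_bump [T2Space A] [LocallyCompactSpace A] (hι : IsClosedEmbedding ι)
    [IsFiniteMeasureOnCompacts μ] [μ.IsOpenPosMeasure] (z : Z) {U : Set Z} (hU : U ∈ 𝓝 z) :
    ∃ f : A → ℝ, Continuous f ∧ HasCompactSupport f ∧ (∀ x, 0 ≤ f x) ∧
      ∫ x, f (ι x) ∂μ = 1 ∧ ∀ x ∉ U, f (ι x) = 0 := by
  -- Positive definiteness is tested with functions on all of `G`, so the bump is built on the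
  -- ambient space `A` and then restricted to the fibre `Z`.
  rw [hι.isInducing.nhds_eq_comap, Filter.mem_comap] at hU
  obtain ⟨V, hV, hVU⟩ := hU
  obtain ⟨W, hWV, hW, hzW⟩ := mem_nhds_iff.1 hV
  obtain ⟨g, hg1, hg0, hgc, hg⟩ := exists_continuous_one_zero_of_isCompact
    (isCompact_singleton (x := ι z)) hW.isClosed_compl (by simpa using hzW)
  have hpos : 0 < ∫ x, g (ι x) ∂μ :=
    Continuous.integral_pos_of_hasCompactSupport_nonneg_nonzero (x := z)
      (g.continuous.comp hι.continuous) (hgc.comp_isClosedEmbedding hι) (fun x => (hg _).1)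
      (by rw [hg1 rfl]; simp)
  refine ⟨fun x => (∫ x, g (ι x) ∂μ)⁻¹ * g x, by fun_prop, hgc.mul_left,
    fun x => mul_nonneg (inv_nonneg.2 hpos.le) (hg x).1, ?_, fun x hx => ?_⟩
  · rw [integral_const_mul, inv_mul_cancel₀ hpos.ne']
  · have : g (ι x) = 0 := hg0 fun h => hx (hVU (hWV h))
    simp [this]

-- Since `f` has total mass one, the difference is `∫ f (e - h) dμ`.
omit [TopologicalSpace Z] [BorelSpace Z] in
theorem norm_integral_bump_smul_sub_le {f : Z → ℝ} (hf : Integrable f μ) (hf0 : ∀ x, 0 ≤ f x)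
    (hf1 : ∫ x, f x ∂μ = 1) {e : Z → H} {h : H} {ε : ℝ} (hfe : Integrable (fun x => (f x : ℂ) • e x) μ)
    (hε : ∀ x, f x ≠ 0 → ‖e x - h‖ ≤ ε) :
    ‖∫ x, (f x : ℂ) • e x ∂μ - h‖ ≤ ε := by
  have h1 : h = ∫ x, (f x : ℂ) • h ∂μ := by
    rw [integral_smul_const, integral_complex_ofReal, hf1]; simp
  have h2 : ε = ∫ x, f x * ε ∂μ := by rw [integral_mul_const, hf1, one_mul]
  conv_lhs => rw [h1]
  have hfh : Integrable (fun x => (f x : ℂ) • h) μ := hf.ofReal.smul_const h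
  rw [← integral_sub hfe hfh]
  conv_rhs => rw [h2]
  refine norm_integral_le_of_norm_le (hf.mul_const ε) (.of_forall fun x => ?_)
  rw [← smul_sub, norm_smul, Complex.norm_real, Real.norm_of_nonneg (hf0 x)]
  by_cases hx : f x = 0
  · simp [hx]
  · exact mul_le_mul_of_nonneg_left (hε x hx) (hf0 x)

/-- A continuous kernel which is positive definite in the integrated sense is positive definite. -/
theorem isPosDefKernel_of_integral_nonneg [SecondCountableTopology Z] [T2Space A]
    [LocallyCompactSpace A] (hι : IsClosedEmbedding ι)
    [IsFiniteMeasureOnCompacts μ] [μ.IsOpenPosMeasure] {k : Z → Z → ℂ}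
    (hk : Continuous fun p : Z × Z => k p.1 p.2)
    (hpos : ∀ f : A → ℂ, Continuous f → HasCompactSupport f →
      0 ≤ ∫ y, ∫ x, k x y * f (ι y) * starRingEnd ℂ (f (ι x)) ∂μ ∂μ) : IsPosDefKernel k := by
  classical
  have : LocallyCompactSpace Z := hι.locallyCompactSpace
  have : T2Space Z := hι.isEmbedding.t2Space
  intro s c
  -- An error of `ε` in each kernel value changes the quadratic form by at most `ε * C`.
  set C : ℝ := ∑ x ∈ s, ∑ y ∈ s, ‖c x‖ * ‖c y‖ with hC
  have hC0 : 0 ≤ C := by positivity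
  -- The nonnegative complex numbers are closed, so it suffices to approximate the form by the
  -- double integrals in `hpos`.
  have hcl : IsClosed {z : ℂ | 0 ≤ z} := isClosed_Ici
  refine hcl.closure_subset (Metric.mem_closure_iff.2 fun δ hδ => ?_)
  obtain ⟨ε, hε, hεδ⟩ : ∃ ε > 0, ε * C < δ := by
    refine ⟨δ / (C + 1), by positivity, ?_⟩
    rw [div_mul_eq_mul_div, div_lt_iff₀ (by positivity)]
    nlinarith
  have hnb : ∃ U : Z → Set Z, (∀ x, U x ∈ 𝓝 x) ∧
      ∀ x ∈ s, ∀ y ∈ s, ∀ x' ∈ U x, ∀ y' ∈ U y, ‖k x' y' - k x y‖ ≤ ε := by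
    have h1 : ∀ x y : Z, ∃ V W : Set Z, V ∈ 𝓝 x ∧ W ∈ 𝓝 y ∧
        ∀ x' ∈ V, ∀ y' ∈ W, ‖k x' y' - k x y‖ ≤ ε := fun x y => by
      have : ∀ᶠ p in 𝓝 (x, y), ‖k p.1 p.2 - k x y‖ < ε := by
        have := (hk.tendsto (x, y)).sub_const (k x y) |>.norm
        simp only [sub_self, norm_zero] at this
        exact this.eventually (gt_mem_nhds hε)
      rw [nhds_prod_eq, Filter.eventually_iff, Filter.mem_prod_iff] at this
      obtain ⟨V, hV, W, hW, h⟩ := this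
      exact ⟨V, W, hV, hW, fun x' hx' y' hy' => (h (Set.mk_mem_prod hx' hy')).le⟩
    choose V W hV hW hVW using h1
    refine ⟨fun x => (⋂ y ∈ s, V x y) ∩ ⋂ y ∈ s, W y x, fun x => Filter.inter_mem ?_ ?_, ?_⟩
    · exact (Filter.biInter_finset_mem s).2 fun y _ => hV x y
    · exact (Filter.biInter_finset_mem s).2 fun y _ => hW y x
    · intro x hx y hy x' hx' y' hy'
      exact hVW x y x' (Set.mem_iInter₂.1 hx'.1 y hy) y' (Set.mem_iInter₂.1 hy'.2 x hx)
  obtain ⟨U, hU, hUk⟩ := hnb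
  choose f hfc hfs hf0 hf1 hfU using fun x => exists_bump (μ := μ) hι x (hU x)
  have hcont : ∀ x, Continuous fun z => f x (ι z) := fun x => (hfc x).comp hι.continuous
  have hsupp : ∀ x, HasCompactSupport fun z => f x (ι z) := fun x =>
    (hfs x).comp_isClosedEmbedding hι
  -- The point masses of the quadratic form are smeared out: `c x` is carried by a unit-mass bump
  -- near `x`.
  let g : A → ℂ := fun a => ∑ x ∈ s, c x * (f x a : ℂ)
  have hgc : Continuous g := continuous_finsetSum _ fun x _ =>
    continuous_const.mul (Complex.continuous_ofReal.comp (hfc x))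
  have hgs : HasCompactSupport g := by
    have : ∀ t : Finset Z, HasCompactSupport fun a => ∑ x ∈ t, c x * (f x a : ℂ) := fun t => by
      induction t using Finset.induction_on with
      | empty =>
        simp only [Finset.sum_empty]
        exact HasCompactSupport.zero
      | insert x t hx ih =>
        simp only [Finset.sum_insert hx]
        exact (((hfs x).comp_left (g := fun r : ℝ => (r : ℂ)) Complex.ofReal_zero).mul_left).add ih
    exact this s
  -- the two-variable bump
  let F : Z → Z → Z × Z → ℝ := fun x y p => f y (ι p.1) * f x (ι p.2)
  have hFc : ∀ x y, Continuous (F x y) := fun x y =>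
    ((hcont y).comp continuous_fst).mul ((hcont x).comp continuous_snd)
  have hprodsupp : ∀ {a b : Z → ℝ}, HasCompactSupport a → HasCompactSupport b →
      HasCompactSupport fun p : Z × Z => a p.1 * b p.2 := fun {a b} ha hb => by
    refine HasCompactSupport.intro (ha.prod hb) fun p hp => ?_
    by_contra hne
    exact hp ⟨subset_tsupport _ (left_ne_zero_of_mul hne),
      subset_tsupport _ (right_ne_zero_of_mul hne)⟩
  have hFs : ∀ x y, HasCompactSupport (F x y) := fun x y => hprodsupp (hsupp y) (hsupp x)
  have hFi : ∀ x y, Integrable (F x y) (μ.prod μ) := fun x y =>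
    (hFc x y).integrable_of_hasCompactSupport (hFs x y)
  have hF1 : ∀ x y, ∫ p, F x y p ∂(μ.prod μ) = 1 := fun x y => by
    simp only [F]
    rw [integral_prod_mul (fun z => f y (ι z)) (fun z => f x (ι z)), hf1, hf1, one_mul]
  have hkc : Continuous fun p : Z × Z => k p.2 p.1 := hk.comp continuous_swap
  have hFk : ∀ x y, Integrable (fun p => (F x y p : ℂ) • k p.2 p.1) (μ.prod μ) := fun x y =>
    integrable_smul_of_hasCompactSupport (Complex.continuous_ofReal.comp (hFc x y))
      ((hFs x y).comp_left (g := fun r : ℝ => (r : ℂ)) Complex.ofReal_zero) hkc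
  have hest : ∀ x ∈ s, ∀ y ∈ s,
      ‖∫ p, (F x y p : ℂ) • k p.2 p.1 ∂(μ.prod μ) - k x y‖ ≤ ε := fun x hx y hy => by
    refine norm_integral_bump_smul_sub_le (hFi x y)
      (fun p => mul_nonneg (hf0 _ _) (hf0 _ _)) (hF1 x y) (hFk x y) fun p hp => ?_
    refine hUk x hx y hy _ ?_ _ ?_
    · by_contra h
      exact hp (by simp [F, hfU x _ h])
    · by_contra h
      exact hp (by simp [F, hfU y _ h])
  refine ⟨_, hpos g hgc hgs, ?_⟩
  have hexp : ∀ p : Z × Z, k p.2 p.1 * g (ι p.1) * starRingEnd ℂ (g (ι p.2)) =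
      ∑ x ∈ s, ∑ y ∈ s, starRingEnd ℂ (c x) * c y * ((F x y p : ℂ) • k p.2 p.1) := fun p => by
    simp only [g, F, map_sum, map_mul, Complex.conj_ofReal, Complex.ofReal_mul, smul_eq_mul,
      Finset.mul_sum, Finset.sum_mul]
    refine Finset.sum_congr rfl fun x _ => Finset.sum_congr rfl fun y _ => by ring
  have hint : ∫ y, ∫ x, k x y * g (ι y) * starRingEnd ℂ (g (ι x)) ∂μ ∂μ =
      ∑ x ∈ s, ∑ y ∈ s, starRingEnd ℂ (c x) * c y * ∫ p, (F x y p : ℂ) • k p.2 p.1 ∂(μ.prod μ) := by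
    rw [← integral_prod (f := fun p : Z × Z => k p.2 p.1 * g (ι p.1) * starRingEnd ℂ (g (ι p.2)))]
    · simp only [hexp]
      rw [integral_finsetSum _ fun x _ => integrable_finsetSum _ fun y _ => (hFk x y).const_mul _]
      refine Finset.sum_congr rfl fun x _ => ?_
      rw [integral_finsetSum _ fun y _ => (hFk x y).const_mul _]
      exact Finset.sum_congr rfl fun y _ => integral_const_mul _ _
    · simp only [hexp]
      exact integrable_finsetSum _ fun x _ => integrable_finsetSum _ fun y _ =>
        (hFk x y).const_mul _
  rw [hint, dist_comm, dist_eq_norm, ← Finset.sum_sub_distrib]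
  simp only [← Finset.sum_sub_distrib, ← mul_sub]
  refine lt_of_le_of_lt ?_ hεδ
  rw [hC, Finset.mul_sum]
  refine norm_sum_le_of_le _ fun x hx => ?_
  rw [Finset.mul_sum]
  refine norm_sum_le_of_le _ fun y hy => ?_
  rw [norm_mul, norm_mul, RCLike.norm_conj, mul_comm]
  exact mul_le_mul_of_nonneg_right (hest x hx y hy) (by positivity)

end Integral

/-! ### Topology of groupoids and their fibres -/

section Topology

variable {X : Type u} [Groupoid.{v} X]

theorem RFiber.toArr_injective {a : X} : Function.Injective (RFiber.toArr (a := a)) := by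
  rintro ⟨s, x⟩ ⟨t, y⟩ h
  cases h
  rfl

theorem RFiber.range_toArr (a : X) : Set.range (RFiber.toArr (a := a)) = {x | x.r = a} := by
  ext ⟨s, t, x⟩
  constructor
  · rintro ⟨y, hy⟩
    rw [← hy]; rfl
  · rintro rfl; exact ⟨⟨s, x⟩, rfl⟩

variable [TopologicalSpace (Arr X)]

theorem RFiber.continuous_toArr (a : X) : Continuous (RFiber.toArr (a := a)) :=
  continuous_induced_dom

variable [TopologicalSpace X] [TopGroupoid X]

variable (X) in
theorem isEmbedding_unit : IsEmbedding (fun a : X => (Arr.of (𝟙 a) : Arr X)) :=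
  Function.LeftInverse.isEmbedding (f := Arr.s) (fun _ => rfl)
    TopGroupoid.continuous_s TopGroupoid.continuous_unit

variable (X) in
theorem t2Space_units [T2Space (Arr X)] : T2Space X := (isEmbedding_unit X).t2Space

theorem RFiber.isClosedEmbedding_toArr [T2Space (Arr X)] (a : X) :
    IsClosedEmbedding (RFiber.toArr (a := a)) := by
  have := t2Space_units X
  refine ⟨⟨⟨rfl⟩, RFiber.toArr_injective⟩, ?_⟩
  rw [RFiber.range_toArr]
  exact isClosed_singleton.preimage TopGroupoid.continuous_r

/-- The product `x y` of elements with `s(x) = r(y)`. -/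
def Arr.mul (x y : Arr X) (h : x.s = y.r) : Arr X :=
  Arr.of (y.hom ≫ eqToHom h.symm ≫ x.hom)

/-- `G²` carries the topology induced from `G × G`, so continuity of the pair suffices; `eqToHom`
only makes the factors composable. -/
theorem Arr.continuous_mul {Y : Type*} [TopologicalSpace Y] {f g : Y → Arr X}
    (hf : Continuous f) (hg : Continuous g) (h : ∀ y, (f y).s = (g y).r) :
    Continuous fun y => Arr.mul (f y) (g y) (h y) := by
  let m : Y → Composable X := fun y =>
    ⟨(g y).left, (f y).left, (f y).right, (g y).hom ≫ eqToHom (h y).symm, (f y).hom⟩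
  have hm : Continuous m := by
    rw [continuous_induced_rng]
    refine (hf.prodMk hg).congr fun y => ?_
    have : ∀ (x z : Arr X) (hxz : x.s = z.r), (x, z) =
        Composable.toPair ⟨z.left, x.left, x.right, z.hom ≫ eqToHom hxz.symm, x.hom⟩ := by
      rintro ⟨a, b, x⟩ ⟨c, d, z⟩ hxz
      cases hxz
      simp [Composable.toPair]
    exact this _ _ (h y)
  refine (TopGroupoid.continuous_mul.comp hm).congr fun y => ?_
  simp [m, Composable.mul, Arr.mul]

theorem RFiber.continuous_invMul (a : X) :
    Continuous fun p : RFiber X a × RFiber X a => p.1.invMul p.2 := by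
  have h1 : Continuous fun p : RFiber X a × RFiber X a => p.1.toArr.inv :=
    TopGroupoid.continuous_inv.comp ((RFiber.continuous_toArr a).comp continuous_fst)
  have h2 : Continuous fun p : RFiber X a × RFiber X a => p.2.toArr :=
    (RFiber.continuous_toArr a).comp continuous_snd
  refine (Arr.continuous_mul h1 h2 fun p => rfl).congr fun p => ?_
  simp [Arr.mul, Arr.inv, RFiber.invMul, RFiber.toArr]

/-- A bounded continuous function on `G` which on each fibre `Gᵘ` is of the form
`φ(y⁻¹x) = (e x, e y)` is positive definite. -/
theorem mem_posDef_of_inner [T2Space (Arr X)] [SecondCountableTopology (Arr X)]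
    {lam : ∀ a : X, Measure (RFiber X a)} (hlam : ∀ a, IsFiniteMeasureOnCompacts (lam a))
    {H : X → Type*} [∀ a, NormedAddCommGroup (H a)] [∀ a, InnerProductSpace ℂ (H a)]
    [∀ a, CompleteSpace (H a)] {φ : Arr X → ℂ} (hφ : Continuous φ) (hb : ∃ C : ℝ, ∀ x, ‖φ x‖ ≤ C)
    (e : ∀ a, RFiber X a → H a) (he : ∀ a x y, φ (y.invMul x) = inner ℂ (e a x) (e a y)) :
    φ ∈ PosDef lam := by
  refine ⟨hφ, hb, fun a f hf hfc => ?_⟩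
  have := hlam a
  simp only [he]
  have hc : Continuous (e a) := continuous_of_continuous_inner <| by
    simp only [← he]
    exact hφ.comp ((RFiber.continuous_invMul a).comp continuous_swap)
  exact integral_integral_inner_nonneg (hf.comp (RFiber.continuous_toArr a))
    (hfc.comp_isClosedEmbedding (RFiber.isClosedEmbedding_toArr a)) hc

theorem isPosDefKernel_of_mem_posDef [T2Space (Arr X)] [LocallyCompactSpace (Arr X)]
    [SecondCountableTopology (Arr X)]
    {lam : ∀ a : X, Measure (RFiber X a)} (hlam : ∀ a, IsFiniteMeasureOnCompacts (lam a))
    (hlam' : ∀ a, (lam a).IsOpenPosMeasure) {φ : Arr X → ℂ} (hφ : φ ∈ PosDef lam) (a : X) :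
    IsPosDefKernel fun x y : RFiber X a => φ (y.invMul x) := by
  have := hlam a
  have := hlam' a
  have hι := RFiber.isClosedEmbedding_toArr a
  have := hι.isEmbedding.secondCountableTopology
  exact isPosDefKernel_of_integral_nonneg hι (μ := lam a)
    (hφ.1.comp ((RFiber.continuous_invMul a).comp continuous_swap)) (hφ.2.2 a)

end Topology

/-! ### The topological groupoid `G × I₂` -/

section Product

variable {X : Type u} [Groupoid.{v} X] [TopologicalSpace (Arr X)]

/-- `G × I₂` is homeomorphic to `G × (I₂ × I₂)` as a space. -/
def Arr.splitHomeomorph : Arr (X × I₂) ≃ₜ Arr X × I₂ × I₂ :=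
  Equiv.toHomeomorphOfIsInducing
    { toFun := Arr.split
      invFun := fun p => ⟨(p.1.left, p.2.2), (p.1.right, p.2.1), (p.1.hom, ())⟩
      left_inv := fun _ => rfl
      right_inv := fun _ => rfl } ⟨rfl⟩

theorem continuous_toProd_iff {Y : Type*} [TopologicalSpace Y] {f : Y → Arr (X × I₂)} :
    Continuous f ↔ (Continuous fun y => (Arr.split (f y)).1) ∧
      (Continuous fun y => (f y).r.2) ∧ Continuous fun y => (f y).s.2 := by
  rw [continuous_induced_rng, continuous_prodMk, continuous_prodMk]
  rfl

theorem continuous_split : Continuous (Arr.split : Arr (X × I₂) → _) := continuous_induced_dom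

instance [TopologicalSpace X] [TopGroupoid X] : TopGroupoid (X × I₂) where
  continuous_s := (TopGroupoid.continuous_s.comp continuous_split.fst).prodMk
    continuous_split.snd.snd
  continuous_r := (TopGroupoid.continuous_r.comp continuous_split.fst).prodMk
    continuous_split.snd.fst
  continuous_unit := continuous_toProd_iff.2
    ⟨TopGroupoid.continuous_unit.comp continuous_fst, continuous_snd, continuous_snd⟩
  continuous_inv := continuous_toProd_iff.2
    ⟨TopGroupoid.continuous_inv.comp continuous_split.fst, continuous_split.snd.snd,
      continuous_split.snd.fst⟩
  continuous_mul := by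
    have h : Continuous (Composable.toPair : Composable (X × I₂) → _) := continuous_induced_dom
    have h1 := continuous_split.comp h.fst
    have h2 := continuous_split.comp h.snd
    refine continuous_toProd_iff.2 ⟨?_, h1.snd.fst, h2.snd.snd⟩
    let m : Composable (X × I₂) → Composable X := fun p => ⟨p.a.1, p.b.1, p.c.1, p.y.1, p.x.1⟩
    have hm : Continuous m := continuous_induced_rng.2 (h1.fst.prodMk h2.fst)
    exact TopGroupoid.continuous_mul.comp hm

instance : SecondCountableTopology I₂ := by
  have : Countable I₂ := Function.Injective.countable (f := Codiscrete.as) fun a b h => by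
    cases a; cases b; cases h; rfl
  infer_instance

instance [T2Space (Arr X)] : T2Space (Arr (X × I₂)) :=
  Arr.splitHomeomorph.symm.t2Space

instance [LocallyCompactSpace (Arr X)] : LocallyCompactSpace (Arr (X × I₂)) :=
  Arr.splitHomeomorph.isClosedEmbedding.locallyCompactSpace

instance [SecondCountableTopology (Arr X)] : SecondCountableTopology (Arr (X × I₂)) :=
  Arr.splitHomeomorph.secondCountableTopology

theorem Arr.continuous_entry (i j : Fin 2) : Continuous fun x : Arr X => x.entry i j :=
  continuous_toProd_iff.2 ⟨continuous_id, continuous_const, continuous_const⟩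

/-- Forgetting the indices is a continuous left inverse, and the image is the preimage of the
discrete point `j` under the source index. -/
theorem RFiber.isClosedEmbedding_entry (a : X) (i j : Fin 2) :
    IsClosedEmbedding (RFiber.entry (a := a) i j) := by
  have hc : Continuous (RFiber.entry (a := a) i j) :=
    continuous_induced_rng.2 ((Arr.continuous_entry i j).comp (RFiber.continuous_toArr a))
  have hsrc : Continuous fun z : RFiber (X × I₂) (a, ⟨i⟩) => z.src.2 :=
    continuous_split.snd.snd.comp (RFiber.continuous_toArr _)
  have hinv : Continuous fun z : RFiber (X × I₂) (a, ⟨i⟩) => (⟨z.src.1, z.hom.1⟩ : RFiber X a) :=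
    continuous_induced_rng.2 (continuous_split.fst.comp (RFiber.continuous_toArr _))
  refine ⟨Function.LeftInverse.isEmbedding (fun _ => rfl) hinv hc, ?_⟩
  convert! (isClosed_discrete {(⟨j⟩ : I₂)}).preimage hsrc
  ext z
  constructor
  · rintro ⟨x, rfl⟩; rfl
  · rcases z with ⟨⟨s, ⟨j'⟩⟩, x, ⟨⟩⟩
    intro h
    cases h
    exact ⟨⟨s, x⟩, rfl⟩

theorem isFiniteMeasureOnCompacts_prodHaar {lam : ∀ a : X, Measure (RFiber X a)}
    (hlam : ∀ a, IsFiniteMeasureOnCompacts (lam a)) (p : X × I₂) :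
    IsFiniteMeasureOnCompacts (prodHaar lam p) := by
  obtain ⟨a, ⟨i⟩⟩ := p
  have := hlam a
  refine ⟨fun K hK => ?_⟩
  simp only [prodHaar, Measure.coe_finsetSum, Finset.sum_apply]
  refine ENNReal.sum_lt_top.2 fun j _ => ?_
  have hι := RFiber.isClosedEmbedding_entry a i j
  rw [hι.measurableEmbedding.map_apply]
  exact (hι.isCompact_preimage hK).measure_lt_top

theorem isOpenPosMeasure_prodHaar {lam : ∀ a : X, Measure (RFiber X a)}
    (hlam : ∀ a, (lam a).IsOpenPosMeasure) (p : X × I₂) :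
    (prodHaar lam p).IsOpenPosMeasure := by
  obtain ⟨a, ⟨i⟩⟩ := p
  have := hlam a
  refine ⟨fun U hU => ?_⟩
  rintro ⟨⟨⟨s, ⟨j⟩⟩, x, ⟨⟩⟩, hx⟩ h0
  simp only [prodHaar, Measure.coe_finsetSum, Finset.sum_apply, Finset.sum_eq_zero_iff] at h0
  have hι := RFiber.isClosedEmbedding_entry a i j
  have := h0 j (Finset.mem_univ j)
  rw [hι.measurableEmbedding.map_apply] at this
  exact (hU.preimage hι.continuous).measure_ne_zero (lam a) ⟨⟨s, x⟩, hx⟩ this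

end Product

/-! ### Haar systems and parametrized integrals -/

section ParamIntegral

variable {X : Type u} [Groupoid.{v} X] [TopologicalSpace X] [TopologicalSpace (Arr X)]
  [TopGroupoid X] [T2Space (Arr X)] {lam : ∀ a : X, Measure (RFiber X a)}

theorem IsHaarSystem.integrable_comp_toArr (hlam : IsHaarSystem lam) (a : X) {f : Arr X → ℂ}
    (hf : Continuous f) (hfc : HasCompactSupport f) :
    Integrable (fun x : RFiber X a => f x.toArr) (lam a) := by
  have := hlam.finite_on_compacts a
  exact (hf.comp (RFiber.continuous_toArr a)).integrable_of_hasCompactSupport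
    (hfc.comp_isClosedEmbedding (RFiber.isClosedEmbedding_toArr a))

/-- Freezing `h` at `y₀` reduces to continuity of the Haar system. The error is small because `h(y,
·)` tends to `h(y₀, ·)` uniformly on the compact support of `f`, while `∫ |f| dλ` stays locally
bounded. -/
theorem IsHaarSystem.continuous_integral_prod (hlam : IsHaarSystem lam) {Y : Type*}
    [TopologicalSpace Y] {p : Y → X} (hp : Continuous p) {f : Arr X → ℂ} (hf : Continuous f)
    (hfc : HasCompactSupport f) {h : Y × Arr X → ℂ} (hh : Continuous h) :
    Continuous fun y => ∫ x : RFiber X (p y), f x.toArr * h (y, x.toArr) ∂lam (p y) := by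
  have hcomp : ∀ y, Continuous fun w : Arr X => h (y, w) := fun y =>
    hh.comp (continuous_const.prodMk continuous_id)
  rw [continuous_iff_continuousAt]
  intro y₀
  have hmain : Continuous fun y => ∫ x : RFiber X (p y), f x.toArr * h (y₀, x.toArr) ∂lam (p y) :=
    (hlam.continuous_integral (fun w => f w * h (y₀, w)) (hf.mul (hcomp y₀)) hfc.mul_right).comp hp
  have habs : Continuous fun y => ‖∫ x : RFiber X (p y), ((‖f x.toArr‖ : ℝ) : ℂ) ∂lam (p y)‖ :=
    ((hlam.continuous_integral (fun w => ((‖f w‖ : ℝ) : ℂ)) (by fun_prop)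
      (hfc.norm.comp_left (g := fun r : ℝ => (r : ℂ)) Complex.ofReal_zero)).comp hp).norm
  set M : ℝ := ‖∫ x : RFiber X (p y₀), ((‖f x.toArr‖ : ℝ) : ℂ) ∂lam (p y₀)‖ + 1 with hM
  have hMpos : 0 < M := by positivity
  rw [ContinuousAt, Metric.tendsto_nhds]
  intro ε hε
  obtain ⟨δ, hδ, hδε⟩ : ∃ δ > 0, δ * M < ε / 2 := ⟨ε / (4 * M), by positivity, by
    field_simp; norm_num⟩
  have hunif : ∀ᶠ y in 𝓝 y₀, ∀ w ∈ tsupport f, ‖h (y, w) - h (y₀, w)‖ < δ := by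
    refine hfc.isCompact.eventually_forall_of_forall_eventually fun w _ => ?_
    have hc : Continuous fun q : Y × Arr X => ‖h (q.1, q.2) - h (y₀, q.2)‖ :=
      (hh.sub ((hcomp y₀).comp continuous_snd)).norm
    have := hc.tendsto (y₀, w)
    simp only [sub_self, norm_zero] at this
    exact this.eventually (gt_mem_nhds hδ)
  have hMev : ∀ᶠ y in 𝓝 y₀,
      ‖∫ x : RFiber X (p y), ((‖f x.toArr‖ : ℝ) : ℂ) ∂lam (p y)‖ < M :=
    (habs.tendsto y₀).eventually (gt_mem_nhds (by rw [hM]; linarith))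
  filter_upwards [hunif, hMev, Metric.tendsto_nhds.1 (hmain.tendsto y₀) (ε / 2) (half_pos hε)]
    with y h1 h2 h3
  refine (dist_triangle _ _ _).trans_lt ((add_lt_add_of_le_of_lt ?_ h3).trans_eq (add_halves ε))
  have hi : ∀ y', Integrable (fun x : RFiber X (p y) => f x.toArr * h (y', x.toArr)) (lam (p y)) :=
    fun y' => hlam.integrable_comp_toArr (p y) (f := fun w => f w * h (y', w))
      (hf.mul (hcomp y')) hfc.mul_right
  rw [dist_eq_norm, ← integral_sub (hi y) (hi y₀)]
  have hnorm : Integrable (fun x : RFiber X (p y) => ‖f x.toArr‖) (lam (p y)) :=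
    (hlam.integrable_comp_toArr (p y) hf hfc).norm
  calc _ ≤ ∫ x : RFiber X (p y), δ * ‖f x.toArr‖ ∂lam (p y) := by
        refine norm_integral_le_of_norm_le (hnorm.const_mul δ) (.of_forall fun x => ?_)
        rw [← mul_sub, norm_mul, mul_comm]
        by_cases hx : x.toArr ∈ tsupport f
        · exact mul_le_mul_of_nonneg_right (h1 _ hx).le (norm_nonneg _)
        · simp [image_eq_zero_of_notMem_tsupport hx]
    _ = δ * ‖∫ x : RFiber X (p y), ((‖f x.toArr‖ : ℝ) : ℂ) ∂lam (p y)‖ := by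
        rw [integral_const_mul, integral_complex_ofReal, Complex.norm_real,
          Real.norm_of_nonneg (integral_nonneg fun _ => norm_nonneg _)]
    _ ≤ ε / 2 := by nlinarith

/-- Continuity of `y ↦ ∫ f(x) h(y, x) dλ^{p(y)}(x)` for `f ∈ C_c(G)` and a continuous function `h`
on the fibre product `{(y, x) : p(y) = r(x)}`. -/
theorem IsHaarSystem.continuous_integral_fiberProd (hlam : IsHaarSystem lam) {Y : Type*}
    [TopologicalSpace Y] [NormalSpace (Y × Arr X)] {p : Y → X} (hp : Continuous p)
    {f : Arr X → ℂ} (hf : Continuous f) (hfc : HasCompactSupport f)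
    {h : {q : Y × Arr X // p q.1 = q.2.r} → ℂ} (hh : Continuous h) :
    Continuous fun y => ∫ x : RFiber X (p y), f x.toArr * h ⟨(y, x.toArr), rfl⟩ ∂lam (p y) := by
  have := t2Space_units X
  have hcl : IsClosed {q : Y × Arr X | p q.1 = q.2.r} :=
    isClosed_eq (hp.comp continuous_fst) (TopGroupoid.continuous_r.comp continuous_snd)
  -- The fibre product is closed because the unit space is Hausdorff, so Tietze extends `h` to the
  -- whole product.
  obtain ⟨g, hg⟩ := ContinuousMap.exists_restrict_eq hcl ⟨h, hh⟩
  refine (hlam.continuous_integral_prod hp hf hfc g.continuous).congr fun y => ?_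
  refine integral_congr_ae (.of_forall fun x => ?_)
  have := DFunLike.congr_fun hg ⟨(y, x.toArr), rfl⟩
  simp only [ContinuousMap.restrict_apply, ContinuousMap.coe_mk] at this
  simp only [this]

end ParamIntegral

/-! ### Continuous fields generated by a space of sections -/

section Presections

variable {X : Type u} [TopologicalSpace X] {H : X → Type w} [∀ a, NormedAddCommGroup (H a)]
  [∀ a, InnerProductSpace ℂ (H a)]

/-- The sections which are locally uniform limits of elements of `S`. -/
def localClosure (S : Submodule ℂ (∀ a, H a)) : Submodule ℂ (∀ a, H a) where
  carrier := {ξ | ∀ a, ∀ ε > (0 : ℝ), ∃ ξ' ∈ S, ∀ᶠ b in 𝓝 a, ‖ξ b - ξ' b‖ ≤ ε}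
  zero_mem' := fun _ ε hε => ⟨0, S.zero_mem, .of_forall fun _ => by simp [hε.le]⟩
  add_mem' := fun {ξ η} hξ hη a ε hε => by
    obtain ⟨ξ', hξ', h1⟩ := hξ a (ε / 2) (half_pos hε)
    obtain ⟨η', hη', h2⟩ := hη a (ε / 2) (half_pos hε)
    refine ⟨ξ' + η', S.add_mem hξ' hη', ?_⟩
    filter_upwards [h1, h2] with b hb1 hb2
    rw [Pi.add_apply, Pi.add_apply, add_sub_add_comm]
    exact (norm_add_le_of_le hb1 hb2).trans_eq (add_halves ε)
  smul_mem' := fun c ξ hξ a ε hε => by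
    obtain ⟨ξ', hξ', h1⟩ := hξ a (ε / (‖c‖ + 1)) (by positivity)
    refine ⟨c • ξ', S.smul_mem c hξ', ?_⟩
    filter_upwards [h1] with b hb
    rw [Pi.smul_apply, Pi.smul_apply, ← smul_sub, norm_smul]
    rw [le_div_iff₀ (by positivity)] at hb
    nlinarith [norm_nonneg (ξ b - ξ' b)]

theorem le_localClosure (S : Submodule ℂ (∀ a, H a)) : S ≤ localClosure S :=
  fun ξ hξ _ ε hε => ⟨ξ, hξ, .of_forall fun _ => by simp [hε.le]⟩

/-- Local closure is idempotent, which is the closure axiom of a continuous field. -/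
theorem mem_localClosure_of_forall {S : Submodule ℂ (∀ a, H a)} {ξ : ∀ a, H a}
    (h : ∀ a, ∀ ε > (0 : ℝ), ∃ ξ' ∈ localClosure S, ∀ᶠ b in 𝓝 a, ‖ξ b - ξ' b‖ ≤ ε) :
    ξ ∈ localClosure S := fun a ε hε => by
  obtain ⟨ξ', hξ', h1⟩ := h a (ε / 2) (half_pos hε)
  obtain ⟨ξ'', hξ'', h2⟩ := hξ' a (ε / 2) (half_pos hε)
  refine ⟨ξ'', hξ'', ?_⟩
  filter_upwards [h1, h2] with b hb1 hb2
  rw [← sub_add_sub_cancel]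
  exact (norm_add_le_of_le hb1 hb2).trans_eq (add_halves ε)

theorem continuous_norm_of_mem_localClosure {S : Submodule ℂ (∀ a, H a)}
    (hS : ∀ ξ ∈ S, Continuous fun a => ‖ξ a‖) {ξ : ∀ a, H a} (hξ : ξ ∈ localClosure S) :
    Continuous fun a => ‖ξ a‖ := by
  rw [continuous_iff_continuousAt]
  intro a
  rw [ContinuousAt, Metric.tendsto_nhds]
  intro ε hε
  obtain ⟨ξ', hξ', h1⟩ := hξ a (ε / 3) (by positivity)
  filter_upwards [h1, Metric.tendsto_nhds.1 ((hS ξ' hξ').tendsto a) (ε / 4) (by positivity)]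
    with b hb1 hb2
  have h3 := (abs_norm_sub_norm_le _ _).trans hb1
  have h4 := (abs_norm_sub_norm_le _ _).trans h1.self_of_nhds
  rw [Real.dist_eq] at *
  rw [abs_le] at h3 h4
  rw [abs_lt] at *
  constructor <;> linarith [h3.1, h3.2, h4.1, h4.2, hb2.1, hb2.2]

/-- A section with continuous norm and continuous inner products with a pointwise dense space of
continuous sections is a local uniform limit of such sections. -/
theorem mem_localClosure_of_continuous_inner {S : Submodule ℂ (∀ a, H a)}
    (hd : ∀ a, Dense {h : H a | ∃ ξ ∈ S, ξ a = h})
    (hS : ∀ ξ ∈ S, Continuous fun a => ‖ξ a‖) {ξ : ∀ a, H a} (hξ : Continuous fun a => ‖ξ a‖)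
    (hξS : ∀ η ∈ S, Continuous fun a => inner ℂ (ξ a) (η a)) : ξ ∈ localClosure S :=
  fun a ε hε => by
  obtain ⟨_, ⟨η, hη, rfl⟩, hη'⟩ := Metric.mem_closure_iff.1 (hd a (ξ a)) ε hε
  rw [dist_eq_norm] at hη'
  -- Expanding the square shows that the error is continuous in the base point, so an approximation
  -- at `a` persists nearby.
  have hc : Continuous fun b => ‖ξ b - η b‖ ^ 2 := by
    simp only [@norm_sub_sq ℂ]
    exact ((hξ.pow 2).sub (continuous_const.mul (Complex.continuous_re.comp (hξS η hη)))).add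
      ((hS η hη).pow 2)
  refine ⟨η, hη, ?_⟩
  filter_upwards [(hc.tendsto a).eventually
    (gt_mem_nhds ((pow_lt_pow_left₀ hη' (norm_nonneg _) two_ne_zero : _ < ε ^ 2)))] with b hb
  exact (lt_of_pow_lt_pow_left₀ 2 hε.le hb).le

/-- The continuous field of Hilbert spaces generated by a pointwise dense linear space of sections
with continuous norms. -/
def HilbertBundle.ofSections [∀ a, CompleteSpace (H a)]
    [∀ a, TopologicalSpace.SeparableSpace (H a)] (S : Submodule ℂ (∀ a, H a))
    (hd : ∀ a, Dense {h : H a | ∃ ξ ∈ S, ξ a = h})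
    (hS : ∀ ξ ∈ S, Continuous fun a => ‖ξ a‖) : HilbertBundle.{w} X where
  H := H
  Γ := localClosure S
  dense := fun a => by
    refine (hd a).mono ?_
    rintro _ ⟨ξ, hξ, rfl⟩
    exact ⟨ξ, le_localClosure S hξ, rfl⟩
  continuous_norm := fun ξ hξ => continuous_norm_of_mem_localClosure hS hξ
  locally_closed := fun _ hξ => mem_localClosure_of_forall hξ

variable [Groupoid.{v} X] [TopologicalSpace (Arr X)] [TopGroupoid X]

/-- The `L_x` are isometries, so locally uniform approximation of the sections at source and range
gives locally uniform approximation of the coefficient. -/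
theorem continuous_coeff_of_mem_localClosure {S : Submodule ℂ (∀ a, H a)}
    (hS : ∀ ξ ∈ S, Continuous fun a => ‖ξ a‖)
    (L : ∀ {a b : X}, (a ⟶ b) → (H a ≃ₗᵢ[ℂ] H b))
    (hL : ∀ ξ ∈ S, ∀ η ∈ S,
      Continuous fun x : Arr X => inner ℂ (L x.hom (ξ x.left)) (η x.right))
    {ξ η : ∀ a, H a} (hξ : ξ ∈ localClosure S) (hη : η ∈ localClosure S) :
    Continuous fun x : Arr X => inner ℂ (L x.hom (ξ x.left)) (η x.right) := by
  have hest : ∀ (ξ ξ' η η' : ∀ a, H a) (x : Arr X),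
      ‖(inner ℂ (L x.hom (ξ x.left)) (η x.right) : ℂ) - inner ℂ (L x.hom (ξ' x.left)) (η' x.right)‖
        ≤ ‖ξ x.left - ξ' x.left‖ * ‖η x.right‖ +
          (‖ξ x.left‖ + ‖ξ x.left - ξ' x.left‖) * ‖η x.right - η' x.right‖ := by
    intro ξ ξ' η η' x
    have : (inner ℂ (L x.hom (ξ x.left)) (η x.right) : ℂ) -
        inner ℂ (L x.hom (ξ' x.left)) (η' x.right) =
        inner ℂ (L x.hom (ξ x.left - ξ' x.left)) (η x.right) +
          inner ℂ (L x.hom (ξ' x.left)) (η x.right - η' x.right) := by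
      rw [map_sub, inner_sub_left, inner_sub_right]; ring
    rw [this]
    refine (norm_add_le _ _).trans (add_le_add ((norm_inner_le_norm _ _).trans_eq ?_)
      ((norm_inner_le_norm _ _).trans ?_))
    · rw [LinearIsometryEquiv.norm_map]
    · rw [LinearIsometryEquiv.norm_map]
      refine mul_le_mul_of_nonneg_right ?_ (norm_nonneg _)
      rw [norm_sub_rev]
      simpa [add_comm] using norm_add_le (ξ x.left) (ξ' x.left - ξ x.left)
  rw [continuous_iff_continuousAt]
  intro x₀
  rw [ContinuousAt, Metric.tendsto_nhds]
  intro ε hε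
  -- Near `x₀` the norms grow by less than 1, and `δ ≤ 1` adds at most 1 more; hence the 2. Each
  -- error term in `hest` is then at most `δ * M`.
  set M : ℝ := ‖ξ x₀.left‖ + ‖η x₀.right‖ + 2 with hM
  have hM0 : 0 < M := by positivity
  obtain ⟨δ, hδ, hδ1, hδε⟩ : ∃ δ > 0, δ ≤ 1 ∧ δ * M ≤ ε / 8 := by
    refine ⟨min 1 (ε / (8 * M)), by positivity, min_le_left _ _, ?_⟩
    calc _ ≤ ε / (8 * M) * M := mul_le_mul_of_nonneg_right (min_le_right _ _) hM0.le
      _ = ε / 8 := by field_simp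
  obtain ⟨ξ', hξ', h1⟩ := hξ x₀.left δ hδ
  obtain ⟨η', hη', h2⟩ := hη x₀.right δ hδ
  have hs : Continuous (Arr.s : Arr X → X) := TopGroupoid.continuous_s
  have hr : Continuous (Arr.r : Arr X → X) := TopGroupoid.continuous_r
  have h1' := hs.continuousAt.eventually (p := fun b => ‖ξ b - ξ' b‖ ≤ δ) h1
  have h2' := hr.continuousAt.eventually (p := fun b => ‖η b - η' b‖ ≤ δ) h2
  have hξb := (((continuous_norm_of_mem_localClosure hS hξ).comp hs).tendsto x₀).eventually
    (gt_mem_nhds (lt_add_one _))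
  have hηb := (((continuous_norm_of_mem_localClosure hS hη).comp hr).tendsto x₀).eventually
    (gt_mem_nhds (lt_add_one _))
  have hclose : ∀ᶠ x in 𝓝 x₀, ‖(inner ℂ (L x.hom (ξ x.left)) (η x.right) : ℂ) -
      inner ℂ (L x.hom (ξ' x.left)) (η' x.right)‖ ≤ ε / 4 := by
    filter_upwards [h1', h2', hξb, hηb] with x a1 a2 a3 a4
    simp only [Function.comp] at a1 a2 a3 a4
    refine (hest ξ ξ' η η' x).trans ?_
    have b1 : ‖ξ x.left - ξ' x.left‖ * ‖η x.right‖ ≤ δ * M := by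
      refine mul_le_mul a1 ?_ (norm_nonneg _) hδ.le
      rw [hM]; linarith [norm_nonneg (ξ x₀.left)]
    have b2 : (‖ξ x.left‖ + ‖ξ x.left - ξ' x.left‖) * ‖η x.right - η' x.right‖ ≤ M * δ := by
      refine mul_le_mul ?_ a2 (norm_nonneg _) hM0.le
      rw [hM]; linarith [norm_nonneg (η x₀.right)]
    linarith
  filter_upwards [hclose, Metric.tendsto_nhds.1 ((hL ξ' hξ' η' hη').tendsto x₀) (ε / 4)
    (by positivity)] with x c1 c2
  have c3 := hclose.self_of_nhds
  rw [← dist_eq_norm] at c1 c3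
  rw [dist_comm] at c3
  refine (dist_triangle4 _ (inner ℂ (L x.hom (ξ' x.left)) (η' x.right) : ℂ)
    (inner ℂ (L x₀.hom (ξ' x₀.left)) (η' x₀.right)) _).trans_lt ?_
  linarith

end Presections

/-! ### The `G`-Hilbert bundle of a positive definite matrix-valued function -/

section GNS

theorem IsPosDefKernel.comp {Z Z' : Type*} {k : Z → Z → ℂ} (hk : IsPosDefKernel k) {e : Z' → Z}
    (he : Function.Injective e) : IsPosDefKernel fun x y => k (e x) (e y) := fun s c => by
  have := hk (s.map ⟨e, he⟩) (Function.extend e c 0)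
  simpa only [Finset.sum_map, Function.Embedding.coeFn_mk, he.extend_apply] using this

variable {X : Type u} [Groupoid.{v} X]

theorem RFiber.translate_invMul_translate {a b : X} (z : a ⟶ b) (y x : RFiber X a) :
    (y.translate z).invMul (x.translate z) = y.invMul x := by
  simp [RFiber.invMul, RFiber.translate]

theorem RFiber.translate_surjective {a b : X} (z : a ⟶ b) :
    Function.Surjective (RFiber.translate z) := fun x =>
  ⟨⟨x.src, x.hom ≫ Groupoid.inv z⟩, by simp [RFiber.translate]⟩

theorem RFiber.translate_translate {a b c : X} (y : a ⟶ b) (z : b ⟶ c) (x : RFiber X a) :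
    (x.translate y).translate z = x.translate (y ≫ z) := by
  simp [RFiber.translate]

/-- The unit `u` as an element of `Gᵘ`. -/
def RFiber.unit (a : X) : RFiber X a := ⟨a, 𝟙 a⟩

/-- A family of vectors `e(x, j)`, `x ∈ Gᵘ`, with `(e(x, j), e(y, i)) = kᵢⱼ(y⁻¹x)`, which span dense
subspaces. -/
structure IsGNSFamily {J : Type*} (k : J → J → Arr X → ℂ) {H : X → Type w}
    [∀ a, NormedAddCommGroup (H a)] [∀ a, InnerProductSpace ℂ (H a)]
    (e : ∀ a, RFiber X a → J → H a) : Prop where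
  inner_eq : ∀ a x y i j, inner ℂ (e a x j) (e a y i) = k i j (y.invMul x)
  dense : ∀ a, (Submodule.span ℂ (Set.range fun p : RFiber X a × J => e a p.1 p.2)).topologicalClosure
    = ⊤

variable {J : Type*} {k : J → J → Arr X → ℂ} {H : X → Type w}
  [∀ a, NormedAddCommGroup (H a)] [∀ a, InnerProductSpace ℂ (H a)]
  {e : ∀ a, RFiber X a → J → H a}

/-- The action of `G`, given by left translation of the spanning vectors. -/
theorem IsGNSFamily.exists_action [∀ a, CompleteSpace (H a)] (he : IsGNSFamily k e) :
    ∃ L : ∀ {a b : X}, (a ⟶ b) → (H a ≃ₗᵢ[ℂ] H b),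
      (∀ {a b : X} (z : a ⟶ b) (x : RFiber X a) (j : J), L z (e a x j) = e b (x.translate z) j) ∧
      (∀ (a : X) (h : H a), L (𝟙 a) h = h) ∧
      ∀ {a b c : X} (y : a ⟶ b) (z : b ⟶ c) (h : H a), L (y ≫ z) h = L z (L y h) := by
  have h1 : ∀ {a b : X} (z : a ⟶ b), ∃ L : H a ≃ₗᵢ[ℂ] H b,
      ∀ p : RFiber X a × J, L (e a p.1 p.2) = e b (p.1.translate z) p.2 := fun {a b} z => by
    -- Translation by `z` maps the spanning vectors onto those over `b`, and `(zy)⁻¹(zx) = y⁻¹x`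
    -- keeps their Gram kernel.
    refine exists_linearIsometryEquiv (he.dense a) ?_ fun p q => ?_
    · have : (Set.range fun p : RFiber X a × J => e b (p.1.translate z) p.2) =
          Set.range fun p : RFiber X b × J => e b p.1 p.2 :=
        ((RFiber.translate_surjective z).prodMap Function.surjective_id).range_comp
          fun p : RFiber X b × J => e b p.1 p.2
      rw [this, he.dense b]
    · rw [he.inner_eq, he.inner_eq, RFiber.translate_invMul_translate]
  choose L hL using @h1
  refine ⟨L, fun z x j => hL z (x, j), fun a h => ?_, fun {a b c} y z h => ?_⟩
  · have : L (𝟙 a) = LinearIsometryEquiv.refl ℂ (H a) :=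
      linearIsometryEquiv_ext_of_dense (he.dense a) fun p => by
        simp [hL (𝟙 a) p, RFiber.translate]
    exact DFunLike.congr_fun this h
  · have : L (y ≫ z) = (L y).trans (L z) :=
      linearIsometryEquiv_ext_of_dense (he.dense a) fun p => by
        rw [LinearIsometryEquiv.trans_apply, hL, hL, hL z (p.1.translate y, p.2),
          RFiber.translate_translate]
    exact DFunLike.congr_fun this h

theorem IsGNSFamily.norm_unit_sq (he : IsGNSFamily k e) (a : X) (j : J) :
    ‖e a (RFiber.unit a) j‖ ^ 2 = (k j j (Arr.of (𝟙 a))).re := by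
  rw [← @inner_self_eq_norm_sq ℂ, he.inner_eq]
  simp [RFiber.invMul, RFiber.unit]

variable [TopologicalSpace (Arr X)]

/-- The section `u ↦ ∑ⱼ ∫ fⱼ(x) e(x, j) dλᵘ(x)`. -/
def integralSection [Fintype J] (lam : ∀ a : X, Measure (RFiber X a))
    (e : ∀ a, RFiber X a → J → H a) (f : J → Arr X → ℂ) : ∀ a, H a :=
  fun a => ∑ j, ∫ x : RFiber X a, f j x.toArr • e a x j ∂lam a

variable (J X) in
/-- Families of elements of `C_c(G)`. -/
def testFamilies : Submodule ℂ (J → Arr X → ℂ) where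
  carrier := {f | ∀ j, Continuous (f j) ∧ HasCompactSupport (f j)}
  zero_mem' := fun _ => ⟨continuous_const, HasCompactSupport.zero⟩
  add_mem' := fun hf hg j => ⟨(hf j).1.add (hg j).1, (hf j).2.add (hg j).2⟩
  smul_mem' := fun _ _ hf j => ⟨continuous_const.mul (hf j).1, (hf j).2.mul_left⟩

variable [TopologicalSpace X] [TopGroupoid X]

theorem IsGNSFamily.continuous (he : IsGNSFamily k e) (hk : ∀ i j, Continuous (k i j)) (a : X)
    (j : J) : Continuous fun x => e a x j :=
  continuous_of_continuous_inner <| by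
    simp only [he.inner_eq]
    exact (hk j j).comp ((RFiber.continuous_invMul a).comp continuous_swap)

/-- The spanning set is a countable union of continuous images of the second countable fibre. -/
theorem IsGNSFamily.separableSpace [SecondCountableTopology (Arr X)] [T2Space (Arr X)]
    [Countable J] (he : IsGNSFamily k e) (hk : ∀ i j, Continuous (k i j)) (a : X) :
    TopologicalSpace.SeparableSpace (H a) := by
  have := (RFiber.isClosedEmbedding_toArr a).isEmbedding.secondCountableTopology
  have h1 : TopologicalSpace.IsSeparable (Set.range fun p : RFiber X a × J => e a p.1 p.2) := by
    have : (Set.range fun p : RFiber X a × J => e a p.1 p.2) =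
        ⋃ j, Set.range fun x => e a x j := by
      ext h; simp only [Set.mem_range, Set.mem_iUnion, Prod.exists]; rw [exists_comm]
    rw [this]
    exact .iUnion fun j => TopologicalSpace.isSeparable_range (he.continuous hk a j)
  have h2 := (h1.span (R := ℂ)).closure
  rw [← Submodule.topologicalClosure_coe, he.dense a, Submodule.top_coe] at h2
  exact TopologicalSpace.isSeparable_univ_iff.1 h2

variable [T2Space (Arr X)] {lam : ∀ a : X, Measure (RFiber X a)}

theorem IsGNSFamily.integrable (he : IsGNSFamily k e) (hk : ∀ i j, Continuous (k i j))
    (hlam : IsHaarSystem lam) {f : J → Arr X → ℂ} (hf : f ∈ testFamilies X J) (a : X) (j : J) :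
    Integrable (fun x : RFiber X a => f j x.toArr • e a x j) (lam a) := by
  have := hlam.finite_on_compacts a
  exact integrable_smul_of_hasCompactSupport ((hf j).1.comp (RFiber.continuous_toArr a))
    ((hf j).2.comp_isClosedEmbedding (RFiber.isClosedEmbedding_toArr a)) (he.continuous hk a j)

variable [Fintype J]

/-- The linear space of all sections `integralSection lam e f`. -/
def IsGNSFamily.sections (he : IsGNSFamily k e) (hk : ∀ i j, Continuous (k i j))
    (hlam : IsHaarSystem lam) : Submodule ℂ (∀ a, H a) where
  carrier := {ξ | ∃ f ∈ testFamilies X J, ξ = integralSection lam e f}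
  zero_mem' := ⟨0, Submodule.zero_mem _, by ext a; simp [integralSection]⟩
  add_mem' := by
    rintro _ _ ⟨f, hf, rfl⟩ ⟨g, hg, rfl⟩
    refine ⟨f + g, Submodule.add_mem _ hf hg, ?_⟩
    ext a
    simp only [integralSection, Pi.add_apply, add_smul]
    rw [← Finset.sum_add_distrib]
    exact Finset.sum_congr rfl fun j _ =>
      (integral_add (he.integrable hk hlam hf a j) (he.integrable hk hlam hg a j)).symm
  smul_mem' := by
    rintro c _ ⟨f, hf, rfl⟩
    refine ⟨c • f, Submodule.smul_mem _ c hf, ?_⟩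
    ext a
    simp only [integralSection, Pi.smul_apply, smul_assoc, integral_smul, Finset.smul_sum]

variable [∀ a, CompleteSpace (H a)]

theorem IsGNSFamily.inner_integralSection (he : IsGNSFamily k e) (hk : ∀ i j, Continuous (k i j))
    (hlam : IsHaarSystem lam) {f : J → Arr X → ℂ} (hf : f ∈ testFamilies X J) (a : X) (h : H a) :
    inner ℂ h (integralSection lam e f a) =
      ∑ j, ∫ x : RFiber X a, f j x.toArr * inner ℂ h (e a x j) ∂lam a := by
  simp only [integralSection, inner_sum]
  refine Finset.sum_congr rfl fun j _ => ?_
  rw [← integral_inner (he.integrable hk hlam hf a j)]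
  simp only [inner_smul_right]

/-- Pointwise, the integrated sections are dense. -/
theorem IsGNSFamily.dense_sections [LocallyCompactSpace (Arr X)] (he : IsGNSFamily k e)
    (hk : ∀ i j, Continuous (k i j)) (hlam : IsHaarSystem lam) (a : X) :
    Dense {h : H a | ∃ ξ ∈ he.sections hk hlam, ξ a = h} := by
  classical
  let S : Submodule ℂ (H a) := (he.sections hk hlam).map (LinearMap.proj a)
  suffices hS : S.topologicalClosure = ⊤ by
    rw [← Submodule.dense_iff_topologicalClosure_eq_top] at hS
    exact hS
  rw [eq_top_iff, ← he.dense a]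
  refine Submodule.topologicalClosure_minimal _ (Submodule.span_le.2 ?_)
    S.isClosed_topologicalClosure
  rintro _ ⟨⟨x, j⟩, rfl⟩
  refine Metric.mem_closure_iff.2 fun ε hε => ?_
  have := hlam.finite_on_compacts a
  have := hlam.full_support a
  -- Averaging `e a y j` over this neighbourhood moves it by at most `ε / 2`; halving restores the
  -- strict inequality.
  have hU : {y | ‖e a y j - e a x j‖ < ε / 2} ∈ 𝓝 x := by
    have := ((he.continuous hk a j).tendsto x).sub_const (e a x j) |>.norm
    simp only [sub_self, norm_zero] at this
    exact this.eventually (gt_mem_nhds (half_pos hε))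
  obtain ⟨f, hfc, hfs, hf0, hf1, hfU⟩ :=
    exists_bump (μ := lam a) (RFiber.isClosedEmbedding_toArr a) x hU
  let F : J → Arr X → ℂ := Pi.single j fun w => (f w : ℂ)
  have hF : F ∈ testFamilies X J := fun i => by
    by_cases hi : i = j
    · subst hi
      simp only [F, Pi.single_eq_same]
      exact ⟨Complex.continuous_ofReal.comp hfc,
        hfs.comp_left (g := fun r : ℝ => (r : ℂ)) Complex.ofReal_zero⟩
    · simp only [F, Pi.single_eq_of_ne hi]
      exact ⟨continuous_const, HasCompactSupport.zero⟩
  have hsec : integralSection lam e F a = ∫ y : RFiber X a, (f y.toArr : ℂ) • e a y j ∂lam a := by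
    simp only [integralSection]
    rw [Finset.sum_eq_single j]
    · simp [F]
    · intro i _ hi
      simp [F, Pi.single_eq_of_ne hi]
    · simp
  refine ⟨_, ⟨_, ⟨F, hF, rfl⟩, rfl⟩, ?_⟩
  rw [dist_comm, dist_eq_norm]
  refine lt_of_le_of_lt ?_ (half_lt_self hε)
  simp only [LinearMap.proj_apply, hsec]
  have hint := he.integrable hk hlam hF a j
  simp only [F, Pi.single_eq_same] at hint
  refine norm_integral_bump_smul_sub_le
    ((hfc.comp (RFiber.continuous_toArr a)).integrable_of_hasCompactSupport
      (hfs.comp_isClosedEmbedding (RFiber.isClosedEmbedding_toArr a)))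
    (fun y => hf0 _) hf1 hint fun y hy => ?_
  by_contra h
  exact hy (hfU y fun h' => h (le_of_lt h'))

/-- Here `(L_z e(x, j), e(w, i)) = kᵢⱼ(w⁻¹zx)`. The bracketing `(w⁻¹z)x` shows dependence on `w⁻¹z`
alone, as the next proof needs. -/
theorem IsGNSFamily.inner_action_integralSection (he : IsGNSFamily k e)
    (hk : ∀ i j, Continuous (k i j)) (hlam : IsHaarSystem lam)
    {L : ∀ {a b : X}, (a ⟶ b) → (H a ≃ₗᵢ[ℂ] H b)}
    (hL : ∀ {a b : X} (z : a ⟶ b) (x : RFiber X a) (j : J), L z (e a x j) = e b (x.translate z) j)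
    {f : J → Arr X → ℂ} (hf : f ∈ testFamilies X J) {a b : X} (z : a ⟶ b) (w : RFiber X b) (i : J) :
    inner ℂ (L z (integralSection lam e f a)) (e b w i) =
      ∑ j, ∫ x : RFiber X a, starRingEnd ℂ (f j x.toArr) *
        k i j (Arr.mul (Arr.mul w.toArr.inv (Arr.of z) rfl) x.toArr rfl) ∂lam a := by
  have h1 : inner ℂ (L z (integralSection lam e f a)) (e b w i) =
      inner ℂ (integralSection lam e f a) ((L z).symm (e b w i)) := by
    rw [← (L z).inner_map_map (integralSection lam e f a), LinearIsometryEquiv.apply_symm_apply]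
  rw [h1, ← inner_conj_symm, he.inner_integralSection hk hlam hf, map_sum]
  refine Finset.sum_congr rfl fun j _ => ?_
  rw [← integral_conj]
  congr 1; ext x
  rw [map_mul, inner_conj_symm, ← (L z).inner_map_map, LinearIsometryEquiv.apply_symm_apply, hL,
    he.inner_eq]
  congr 2
  simp [Arr.mul, RFiber.invMul, RFiber.translate, Arr.inv, RFiber.toArr]

/-- The coefficient at `z` is the sum over `i` of `∫ gᵢ(w) Kᵢ(w⁻¹z) dλ(w)`, where `Kᵢ` is itself an
integral over a fibre. Continuity on fibre products is applied twice: to `Kᵢ`, then to the outer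
integral. -/
theorem IsGNSFamily.continuous_coeff [NormalSpace (Arr X × Arr X)] (he : IsGNSFamily k e)
    (hk : ∀ i j, Continuous (k i j)) (hlam : IsHaarSystem lam)
    {L : ∀ {a b : X}, (a ⟶ b) → (H a ≃ₗᵢ[ℂ] H b)}
    (hL : ∀ {a b : X} (z : a ⟶ b) (x : RFiber X a) (j : J), L z (e a x j) = e b (x.translate z) j)
    {f g : J → Arr X → ℂ} (hf : f ∈ testFamilies X J) (hg : g ∈ testFamilies X J) :
    Continuous fun x : Arr X =>
      inner ℂ (L x.hom (integralSection lam e f x.left)) (integralSection lam e g x.right) := by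
  let K : J → Arr X → ℂ := fun i y => ∑ j, ∫ x : RFiber X y.s, starRingEnd ℂ (f j x.toArr) *
        k i j (Arr.mul y x.toArr rfl) ∂lam y.s
  have hK : ∀ i, Continuous (K i) := fun i => continuous_finsetSum _ fun j _ =>
    hlam.continuous_integral_fiberProd (p := Arr.s) TopGroupoid.continuous_s
      (f := fun w => starRingEnd ℂ (f j w)) (Complex.continuous_conj.comp (hf j).1)
      ((hf j).2.comp_left (map_zero _))
      (h := fun q => k i j (Arr.mul q.1.1 q.1.2 q.2))
      ((hk i j).comp (Arr.continuous_mul (continuous_fst.comp continuous_subtype_val)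
        (continuous_snd.comp continuous_subtype_val) _))
  have hmain : ∀ i, Continuous fun z : Arr X => ∫ w : RFiber X z.r, g i w.toArr *
      K i (Arr.mul w.toArr.inv z rfl) ∂lam z.r := fun i =>
    hlam.continuous_integral_fiberProd (p := Arr.r) TopGroupoid.continuous_r (hg i).1 (hg i).2
      (h := fun q => K i (Arr.mul q.1.2.inv q.1.1 q.2.symm))
      ((hK i).comp (Arr.continuous_mul (TopGroupoid.continuous_inv.comp
        (continuous_snd.comp continuous_subtype_val)) (continuous_fst.comp continuous_subtype_val) _))
  refine (continuous_finsetSum Finset.univ fun i _ => hmain i).congr fun z => ?_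
  rw [he.inner_integralSection hk hlam hg]
  refine Finset.sum_congr rfl fun i _ => ?_
  congr 1; ext w
  rw [he.inner_action_integralSection hk hlam hL hf]
  rfl

end GNS

/-- A bounded continuous matrix-valued function on `G` which is positive definite on the fibres
is the matrix of coefficients of bounded continuous sections of a `G`-Hilbert bundle. -/
theorem exists_gHilbertBundle {X : Type u} [Groupoid.{v} X] [TopologicalSpace X]
    [TopologicalSpace (Arr X)] [TopGroupoid X] [T2Space (Arr X)] [LocallyCompactSpace (Arr X)]
    [SecondCountableTopology (Arr X)] {lam : ∀ a : X, Measure (RFiber X a)}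
    (hlam : IsHaarSystem lam) {J : Type} [Fintype J] {k : J → J → Arr X → ℂ}
    (hk : ∀ i j, Continuous (k i j)) (hb : ∀ j, ∃ C : ℝ, ∀ x, ‖k j j x‖ ≤ C)
    (hpos : ∀ a, IsPosDefKernel fun p q : RFiber X a × J => k q.2 p.2 (q.1.invMul p.1)) :
    ∃ (E : GHilbertBundle.{max u v} X) (ξ : J → ∀ a, E.H a),
      (∀ j, ξ j ∈ E.boundedSections) ∧
        ∀ i j, coeffFun E.toHilbertBundle E.L (ξ j) (ξ i) = k i j := by
  choose H i1 i2 i3 e' he' hd using fun a => (hpos a).exists_hilbertSpace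
  let e : ∀ a, RFiber X a → J → H a := fun a x j => e' a (x, j)
  have he : IsGNSFamily k e := ⟨fun a x y i j => he' a (x, j) (y, i), hd⟩
  have := he.separableSpace hk
  obtain ⟨L, hL, hL1, hLmul⟩ := he.exists_action
  let S := he.sections hk hlam
  have hcoeff : ∀ ξ ∈ S, ∀ η ∈ S,
      Continuous fun x : Arr X => inner ℂ (L x.hom (ξ x.left)) (η x.right) := by
    rintro _ ⟨f, hf, rfl⟩ _ ⟨g, hg, rfl⟩
    exact he.continuous_coeff hk hlam hL hf hg
  -- On units the coefficient of `ξ` with itself is `‖ξ‖²`.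
  have hnorm : ∀ ξ ∈ S, Continuous fun a => ‖ξ a‖ := fun ξ hξ => by
    have h1 := Complex.continuous_re.comp
      ((hcoeff ξ hξ ξ hξ).comp (TopGroupoid.continuous_unit (X := X)))
    refine (Real.continuous_sqrt.comp h1).congr fun a => ?_
    simp only [Function.comp, hL1]
    exact (@norm_eq_sqrt_re_inner ℂ _ _ _ _ (ξ a)).symm
  have hdense := he.dense_sections hk hlam
  let ξ : J → ∀ a, H a := fun j a => e a (RFiber.unit a) j
  have hξsq : ∀ j a, ‖ξ j a‖ = √(k j j (Arr.of (𝟙 a))).re := fun j a => by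
    rw [← he.norm_unit_sq, Real.sqrt_sq (norm_nonneg _)]
  -- `ξ j` need not be an integrated section, but its inner product with one is the sum over `i` of
  -- `∫ fᵢ(w) kᵢⱼ(w⁻¹) dλ(w)`, continuous by the Haar property.
  have hξ : ∀ j, ξ j ∈ localClosure S := fun j => by
    refine mem_localClosure_of_continuous_inner hdense hnorm ?_ ?_
    · simp only [hξsq]
      exact Real.continuous_sqrt.comp (Complex.continuous_re.comp
        ((hk j j).comp TopGroupoid.continuous_unit))
    · rintro _ ⟨f, hf, rfl⟩
      have : ∀ i, Continuous fun a => ∫ w : RFiber X a, f i w.toArr * k i j w.toArr.inv ∂lam a :=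
        fun i => hlam.continuous_integral (fun w => f i w * k i j w.inv)
          ((hf i).1.mul ((hk i j).comp TopGroupoid.continuous_inv)) (hf i).2.mul_right
      refine (continuous_finsetSum Finset.univ fun i _ => this i).congr fun a => ?_
      rw [he.inner_integralSection hk hlam hf]
      refine Finset.sum_congr rfl fun i _ => ?_
      congr 1; ext w
      rw [he.inner_eq]
      simp [RFiber.invMul, RFiber.unit, Arr.inv, RFiber.toArr]
  let E : GHilbertBundle.{max u v} X :=
    { HilbertBundle.ofSections S hdense hnorm with
      L := L
      L_id := hL1
      L_comp := hLmul
      continuous_coeff := fun ξ hξ η hη =>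
        continuous_coeff_of_mem_localClosure hnorm L hcoeff hξ.1 hη.1 }
  refine ⟨E, ξ, fun j => ⟨hξ j, ?_⟩, fun i j => ?_⟩
  · obtain ⟨C, hC⟩ := hb j
    refine ⟨√C, fun a => (hξsq j a).trans_le (Real.sqrt_le_sqrt ?_)⟩
    exact (Complex.re_le_norm _).trans (hC _)
  · funext x
    change inner ℂ (L x.hom (e x.left (RFiber.unit x.left) j)) (e x.right (RFiber.unit x.right) i) = _
    rw [hL, he.inner_eq]
    simp [RFiber.invMul, RFiber.translate, RFiber.unit]

/-! ### Positive definiteness of coefficients -/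

section Coefficients

variable {X : Type u} [Groupoid.{v} X] [TopologicalSpace X] [TopologicalSpace (Arr X)]

theorem GHilbertBundle.inner_L_L (E : GHilbertBundle.{w} X) {a b c : X} (x : a ⟶ c) (y : b ⟶ c)
    (h : E.H a) (h' : E.H b) :
    inner ℂ (E.L x h) (E.L y h') = inner ℂ (E.L (x ≫ Groupoid.inv y) h) h' := by
  rw [E.L_comp, ← (E.L y).inner_map_map, ← E.L_comp _ y]
  have : E.L (Groupoid.inv y ≫ y) (E.L x h) = E.L x h := by
    rw [Groupoid.inv_comp, E.L_id]
  rw [this]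

theorem GHilbertBundle.coeffFun_invMul (E : GHilbertBundle.{w} X) (ξ η : ∀ a, E.H a) {a : X}
    (y x : RFiber X a) :
    coeffFun E.toHilbertBundle E.L ξ η (y.invMul x) =
      inner ℂ (E.L x.hom (ξ x.src)) (E.L y.hom (η y.src)) := by
  rw [E.inner_L_L]; rfl

theorem GHilbertBundle.adj_coeffFun (E : GHilbertBundle.{w} X) (ξ η : ∀ a, E.H a) :
    adj (coeffFun E.toHilbertBundle E.L ξ η) = coeffFun E.toHilbertBundle E.L η ξ := by
  funext ⟨a, b, x⟩
  have h := E.inner_L_L (𝟙 b) x (ξ b) (η a)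
  simp only [E.L_id, Category.id_comp] at h
  change starRingEnd ℂ (inner ℂ (E.L (Groupoid.inv x) (ξ b)) (η a)) = inner ℂ (E.L x (η a)) (ξ b)
  rw [← h, inner_conj_symm]

theorem GHilbertBundle.exists_norm_coeffFun_le (E : GHilbertBundle.{w} X) {ξ η : ∀ a, E.H a}
    (hξ : ξ ∈ E.boundedSections) (hη : η ∈ E.boundedSections) :
    ∃ C : ℝ, ∀ x, ‖coeffFun E.toHilbertBundle E.L ξ η x‖ ≤ C := by
  obtain ⟨-, C, hC⟩ := hξ
  obtain ⟨-, D, hD⟩ := hη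
  refine ⟨C * D, fun x => (norm_inner_le_norm _ _).trans ?_⟩
  rw [LinearIsometryEquiv.norm_map]
  exact mul_le_mul (hC _) (hD _) (norm_nonneg _) ((norm_nonneg _).trans (hC x.left))

variable [TopGroupoid X] [T2Space (Arr X)] [SecondCountableTopology (Arr X)]
  {lam : ∀ a : X, Measure (RFiber X a)}

theorem GHilbertBundle.coeffFun_self_mem_posDef (E : GHilbertBundle.{w} X)
    (hlam : ∀ a, IsFiniteMeasureOnCompacts (lam a)) {ξ : ∀ a, E.H a}
    (hξ : ξ ∈ E.boundedSections) : coeffFun E.toHilbertBundle E.L ξ ξ ∈ PosDef lam :=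
  mem_posDef_of_inner hlam (E.continuous_coeff ξ hξ ξ hξ) (E.exists_norm_coeffFun_le hξ hξ)
    (fun _ x => E.L x.hom (ξ x.src)) fun _ x y => E.coeffFun_invMul ξ ξ y x

/-- The matrix of coefficients of two sections, as a function on `G × I₂`. -/
def GHilbertBundle.matrixCoeff (E : GHilbertBundle.{w} X) (ξ : Fin 2 → ∀ a, E.H a) :
    Arr (X × I₂) → ℂ :=
  fun z => coeffFun E.toHilbertBundle E.L (ξ z.left.2.as) (ξ z.right.2.as) z.split.1

/-- Over `(u, i)` the kernel is the Gram kernel of the vectors `L_x ξ_j(s(x))` in `H_u`, which do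
not involve `i`. -/
theorem GHilbertBundle.matrixCoeff_mem_posDef (E : GHilbertBundle.{w} X)
    (hlam : ∀ a, IsFiniteMeasureOnCompacts (lam a)) {ξ : Fin 2 → ∀ a, E.H a}
    (hξ : ∀ j, ξ j ∈ E.boundedSections) : E.matrixCoeff ξ ∈ PosDef (prodHaar lam) := by
  refine mem_posDef_of_inner (isFiniteMeasureOnCompacts_prodHaar hlam) ?_ ?_
    (H := fun p : X × I₂ => E.H p.1) (fun p z => E.L z.hom.1 (ξ z.src.2.as z.src.1)) ?_
  · have h : Continuous fun q : Arr X × I₂ × I₂ =>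
        coeffFun E.toHilbertBundle E.L (ξ q.2.2.as) (ξ q.2.1.as) q.1 :=
      continuous_prod_of_discrete_right.2 fun ⟨i, j⟩ =>
        E.continuous_coeff (ξ j.as) (hξ _) (ξ i.as) (hξ _)
    exact h.comp continuous_split
  · choose C hC using fun i j => E.exists_norm_coeffFun_le (hξ i) (hξ j)
    refine ⟨∑ i, ∑ j, |C i j|, fun z => (hC _ _ _).trans ((le_abs_self _).trans ?_)⟩
    exact (Finset.single_le_sum (f := fun j => |C z.left.2.as j|) (fun _ _ => abs_nonneg _)
      (Finset.mem_univ _)).trans (Finset.single_le_sum (f := fun i => ∑ j, |C i j|)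
        (fun _ _ => Finset.sum_nonneg fun _ _ => abs_nonneg _) (Finset.mem_univ _))
  · rintro ⟨a, i⟩ ⟨⟨s, j⟩, x, ⟨⟩⟩ ⟨⟨t, l⟩, y, ⟨⟩⟩
    rw [E.inner_L_L]
    rfl

end Coefficients

end LCGroupoid

end

theorem proposition5 {X : Type u} [Groupoid.{v} X] [TopologicalSpace X]
    [TopologicalSpace (LCGroupoid.Arr X)] [LCGroupoid.TopGroupoid X]
    [T2Space (LCGroupoid.Arr X)] [LocallyCompactSpace (LCGroupoid.Arr X)]
    [SecondCountableTopology (LCGroupoid.Arr X)]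
    (lam : ∀ a : X, Measure (LCGroupoid.RFiber X a)) (hlam : LCGroupoid.IsHaarSystem lam)
    (φ : LCGroupoid.Arr X → ℂ) :
    φ ∈ LCGroupoid.FourierStieltjes X ↔
      ∃ F ∈ LCGroupoid.PosDef (LCGroupoid.prodHaar lam),
        ∃ ρ ∈ LCGroupoid.PosDef lam, ∃ τ ∈ LCGroupoid.PosDef lam,
          ∀ x : LCGroupoid.Arr X,
            LCGroupoid.toMatrix F x = !![ρ x, φ x; LCGroupoid.adj φ x, τ x] := by
  open LCGroupoid in
  have hfin := hlam.finite_on_compacts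
  constructor
  · rintro ⟨E, ξ, hξ, η, hη, rfl⟩
    -- The second index labels the source, hence the section moved by `L_x`; `ξ` must come second
    -- for the entry `(1, 2)` to be `(ξ, η)`.
    refine ⟨E.matrixCoeff ![η, ξ], E.matrixCoeff_mem_posDef hfin (by simp [Fin.forall_fin_two, hξ, hη]),
      _, E.coeffFun_self_mem_posDef hfin hη, _, E.coeffFun_self_mem_posDef hfin hξ, fun x => ?_⟩
    rw [E.adj_coeffFun]
    ext i j
    fin_cases i <;> fin_cases j <;> rfl
  · rintro ⟨F, hF, ρ, hρ, τ, hτ, h⟩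
    have hpos := isPosDefKernel_of_mem_posDef (isFiniteMeasureOnCompacts_prodHaar hfin)
      (isOpenPosMeasure_prodHaar hlam.full_support) hF
    -- Pairs `(x, j)` label the fibre over `(a, 1)`. The common range index cancels in `y⁻¹x`,
    -- leaving the entry indexed by the two sources.
    have hinj : ∀ a : X, Function.Injective
        fun p : RFiber X a × Fin 2 => RFiber.entry (a := a) 0 p.2 p.1 := by
      rintro a ⟨⟨s, x⟩, i⟩ ⟨⟨t, y⟩, j⟩ hxy
      cases hxy
      rfl
    obtain ⟨C, hC⟩ := hF.2.1
    obtain ⟨E, ξ, hξ, hE⟩ := exists_gHilbertBundle hlam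
      (k := fun i j x => F (x.entry i j)) (fun i j => hF.1.comp (Arr.continuous_entry i j))
      (fun j => ⟨C, fun x => hC _⟩) fun a => by
        have := (hpos (a, ⟨0⟩)).comp (hinj a)
        exact this
    refine ⟨E, ξ 1, hξ 1, ξ 0, hξ 0, ?_⟩
    rw [hE]
    funext x
    have := congrFun (congrFun (h x) 0) 1
    simpa [toMatrix] using this.symm
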